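/- Let $d\ge 1$ and $q\in\mathbb C\setminus\{0\}$. For $n\ge 0$ let $B_n$ be the braid group with generators $\sigma_1,\dots,\sigma_{n-1}$, and let $\mathcal F_{d,n}\cong(\mathbb Z/d\mathbb Z)^n\rtimes B_n$ be the modular framed braid group, generated by the $\sigma_i$, subject to the braid relations, together with $t_1,\dots,t_n$, subject to $t_it_j=t_jt_i$, $t_j\sigma_i=\sigma_it_{s_i(j)}$ with $s_i=(i,i+1)$, and $t_j^d=1$. Put $e_i=\frac1d\sum_{s=1}^{d}t_i^st_{i+1}^{-s}\in\mathbb C\mathcal F_{d,n}$. The Yokonuma--Hecke algebra $\mathrm Y_{d,n}(q)$ is the quotient of $\mathbb C\mathcal F_{d,n}$ by the relations $\sigma_i^2=1+(q-q^{-1})e_i\sigma_i$ $(1\le i\le n-1)$; the image of $\sigma_i$ is denoted $g_i$, and braids are identified with their images in $\mathrm Y_{d,n}(q)$. Let $D\subseteq\mathbb Z/d\mathbb Z$ be non-empty, let $\mathrm x_k=\frac1{|D|}\sum_{m\in D}\exp(2\pi\sqrt{-1}\,mk/d)$ $(k\in\mathbb Z/d\mathbb Z)$ be the corresponding solution of the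 E-system $\sum_{s}\mathrm x_{m+s}\mathrm x_{-s}=\mathrm x_m\sum_s\mathrm x_s\mathrm x_{-s}$, $\mathrm x_0=1$, and let $E_D=\frac1d\sum_s\mathrm x_s\mathrm x_{-s}=\frac1{|D|}$. There is a unique linear map $\mathrm{tr}_{d,D}=\mathrm{tr}_{d,D}(q,z):\bigcup_n\mathrm Y_{d,n}(q)\to\mathbb C[z]$ with 1. $\mathrm{tr}_{d,D}(ab)=\mathrm{tr}_{d,D}(ba)$ for $a,b\in\mathrm Y_{d,n}(q)$, 2. $\mathrm{tr}_{d,D}(1)=1$, 3. $\mathrm{tr}_{d,D}(a g_n)=z\,\mathrm{tr}_{d,D}(a)$ for $a\in\mathrm Y_{d,n}(q)$, $n\ge 1$, 4. $\mathrm{tr}_{d,D}(a t_{n+1}^s)=\mathrm x_s\,\mathrm{tr}_{d,D}(a)$ for $a\in\mathrm Y_{d,n}(q)$, $1\le s\le d-1$, and it satisfies $\mathrm{tr}_{d,D}(e_i)=E_D$ for all $i$. For $\alpha\in B_n$ let $\alpha^*$ be the image of $\alpha$ under the automorphism of $B_n$ with $\sigma_i\mapsto\sigma_i^{-1}$. Then,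 for every $n$ and every $\alpha\in B_n$, $$\mathrm{tr}_{d,D}(q,z)(\alpha^*)=\mathrm{tr}_{d,D}\bigl(q^{-1},\,z-(q-q^{-1})E_D\bigr)(\alpha)\quad\text{in }\mathbb C[z],$$ where the right-hand side is the trace on $\mathrm Y_{d,n}(q^{-1})$ with $z-(q-q^{-1})E_D$ substituted for $z$. Equivalently, in terms of the variable $\lambda_D=\frac{z-(q-q^{-1})E_D}{z}$, i.e. writing $\mathrm{tr}_{d,D}(q,\lambda_D)$ for the trace with $z=\frac{(q-q^{-1})E_D}{1-\lambda_D}$ substituted, $$\mathrm{tr}_{d,D}(q,\lambda_D)(\alpha^*)=\mathrm{tr}_{d,D}(q^{-1},\lambda_D^{-1})(\alpha)\qquad(\lambda_D\in\mathbb C\setminus\{0,1\}).$$ -/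

import Mathlib

open Polynomial

namespace YokonumaHecke

noncomputable section

/-! Strands and generators are indexed from `0`: on `n` strands the braiding generators are indexed
by `Fin (n - 1)` and the framing generators by `Fin n`; the braiding generator of index `i` crosses
the strands `i` and `i + 1`. -/

/-! ### The classical braid group and mirror images -/

/-- Artin's braid relations, each relation `a = b` being given by the relator `a * b⁻¹`. -/
inductive BraidRel (n : ℕ) : FreeGroup (Fin (n - 1)) → Prop
  | braid (i j : Fin (n - 1)) (h : (i : ℕ) + 1 = j) :
      BraidRel n (FreeGroup.of i * FreeGroup.of j * FreeGroup.of i *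
        (FreeGroup.of j * FreeGroup.of i * FreeGroup.of j)⁻¹)
  | comm (i j : Fin (n - 1)) (h : (i : ℕ) + 1 < j) :
      BraidRel n (FreeGroup.of i * FreeGroup.of j * (FreeGroup.of j * FreeGroup.of i)⁻¹)

/-- The classical braid group `B_n`. -/
abbrev Braid (n : ℕ) : Type := PresentedGroup {r | BraidRel n r}

/-- The standard generator `σ_i` of `B_n`. -/
def Braid.sigma {n : ℕ} (i : Fin (n - 1)) : Braid n := PresentedGroup.of i

theorem Braid.sigma_braid {n : ℕ} (i j : Fin (n - 1)) (h : (i : ℕ) + 1 = j) :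
    sigma i * sigma j * sigma i = sigma j * sigma i * sigma j :=
  mul_inv_eq_one.mp
    (PresentedGroup.one_of_mem (rels := {r | BraidRel n r}) (BraidRel.braid i j h))

theorem Braid.sigma_comm {n : ℕ} (i j : Fin (n - 1)) (h : (i : ℕ) + 1 < j) :
    sigma i * sigma j = sigma j * sigma i :=
  mul_inv_eq_one.mp
    (PresentedGroup.one_of_mem (rels := {r | BraidRel n r}) (BraidRel.comm i j h))

/-- The mirror image `α ↦ α^*`: the endomorphism of `B_n` with `σ_i ↦ σ_i⁻¹`. -/
def Braid.mirror (n : ℕ) : Braid n →* Braid n :=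
  PresentedGroup.toGroup (f := fun i => (Braid.sigma i)⁻¹) (by
    rintro r (⟨i, j, h⟩ | ⟨i, j, h⟩)
    · have := congrArg (·⁻¹) (Braid.sigma_braid i j h)
      simp only [map_mul, map_inv, FreeGroup.lift_apply_of, mul_inv_eq_one]
      simpa [mul_assoc] using this
    · have := congrArg (·⁻¹) (Braid.sigma_comm i j h)
      simp only [map_mul, map_inv, FreeGroup.lift_apply_of, mul_inv_eq_one]
      simpa using this.symm)

/-! ### The modular framed braid group -/

/-- The generators of the framed braid group on `n` strands. -/
inductive FramedGen (n : ℕ) : Type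
  | sigma (i : Fin (n - 1))
  | t (j : Fin n)

/-- The strand `i` as an element of `Fin n`, for an index `i` of a braiding generator. -/
def lo {n : ℕ} (i : Fin (n - 1)) : Fin n := ⟨i, by omega⟩

/-- The strand `i + 1` as an element of `Fin n`, for an index `i` of a braiding generator. -/
def hi {n : ℕ} (i : Fin (n - 1)) : Fin n := ⟨i + 1, by omega⟩

section
open FramedGen FreeGroup

/-- The relators `a * b⁻¹` of the defining relations `a = b` of the modular framed braid group. -/
inductive FramedRel (d n : ℕ) : FreeGroup (FramedGen n) → Prop
  | braid (i j : Fin (n - 1)) (h : (i : ℕ) + 1 = j) :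
      FramedRel d n (of (sigma i) * of (sigma j) * of (sigma i) *
        (of (sigma j) * of (sigma i) * of (sigma j))⁻¹)
  | comm (i j : Fin (n - 1)) (h : (i : ℕ) + 1 < j) :
      FramedRel d n (of (sigma i) * of (sigma j) * (of (sigma j) * of (sigma i))⁻¹)
  | framing_comm (i j : Fin n) :
      FramedRel d n (of (t i) * of (t j) * (of (t j) * of (t i))⁻¹)
  | framing_braid (i : Fin (n - 1)) (j : Fin n) :
      FramedRel d n (of (t j) * of (sigma i) *
        (of (sigma i) * of (t (Equiv.swap (lo i) (hi i) j)))⁻¹)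
  | modular (j : Fin n) : FramedRel d n (of (t j) ^ d)

end

/-- The modular framed braid group `F_{d,n}`. -/
abbrev Framed (d n : ℕ) : Type := PresentedGroup {r | FramedRel d n r}

namespace Framed

/-- The braiding generator `σ_i` of `F_{d,n}`. -/
def sigma {d n : ℕ} (i : Fin (n - 1)) : Framed d n := PresentedGroup.of (FramedGen.sigma i)

/-- The framing generator `t_j` of `F_{d,n}`. -/
def t {d n : ℕ} (j : Fin n) : Framed d n := PresentedGroup.of (FramedGen.t j)

variable {d n : ℕ}

theorem rel_eq_one {r : FreeGroup (FramedGen n)} (h : FramedRel d n r) :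
    PresentedGroup.mk {r | FramedRel d n r} r = 1 :=
  PresentedGroup.one_of_mem (rels := {r | FramedRel d n r}) h

theorem sigma_braid (i j : Fin (n - 1)) (h : (i : ℕ) + 1 = j) :
    (sigma i * sigma j * sigma i : Framed d n) = sigma j * sigma i * sigma j :=
  mul_inv_eq_one.mp (rel_eq_one (FramedRel.braid i j h))

theorem sigma_comm (i j : Fin (n - 1)) (h : (i : ℕ) + 1 < j) :
    (sigma i * sigma j : Framed d n) = sigma j * sigma i :=
  mul_inv_eq_one.mp (rel_eq_one (FramedRel.comm i j h))

theorem t_comm (i j : Fin n) : (t i * t j : Framed d n) = t j * t i :=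
  mul_inv_eq_one.mp (rel_eq_one (FramedRel.framing_comm i j))

theorem t_sigma (i : Fin (n - 1)) (j : Fin n) :
    (t j * sigma i : Framed d n) = sigma i * t (Equiv.swap (lo i) (hi i) j) :=
  mul_inv_eq_one.mp (rel_eq_one (FramedRel.framing_braid i j))

theorem t_pow (j : Fin n) : (t j : Framed d n) ^ d = 1 :=
  rel_eq_one (FramedRel.modular j)

/-- The natural homomorphism `B_n → F_{d,n}`, `σ_i ↦ σ_i` (all framings zero). -/
def ofBraid (d n : ℕ) : Braid n →* Framed d n :=
  PresentedGroup.toGroup (f := fun i => sigma i) (by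
    rintro r (⟨i, j, h⟩ | ⟨i, j, h⟩)
    · simpa only [map_mul, map_inv, FreeGroup.lift_apply_of, mul_inv_eq_one] using sigma_braid i j h
    · simpa only [map_mul, map_inv, FreeGroup.lift_apply_of, mul_inv_eq_one] using sigma_comm i j h)

/-- The index of a braiding generator, seen on one more strand. -/
def up {n : ℕ} (i : Fin (n - 1)) : Fin (n + 1 - 1) := ⟨i, by omega⟩

theorem castSucc_swap (i : Fin (n - 1)) (j : Fin n) :
    (Equiv.swap (lo i) (hi i) j).castSucc =
      Equiv.swap (lo (up i)) (hi (up i)) j.castSucc := by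
  have := (Fin.castSucc_injective n).map_swap (x := lo i) (y := hi i) (z := j)
  simpa [lo, hi, up] using this

/-- The natural homomorphism `F_{d,n} → F_{d,n+1}`, adding a strand of framing zero on the right. -/
def succ (d n : ℕ) : Framed d n →* Framed d (n + 1) :=
  PresentedGroup.toGroup
    (f := fun x => match x with
      | FramedGen.sigma i => sigma (up i)
      | FramedGen.t j => t j.castSucc) (by
    rintro r (⟨i, j, h⟩ | ⟨i, j, h⟩ | ⟨i, j⟩ | ⟨i, j⟩ | ⟨j⟩)
    · simpa only [map_mul, map_inv, FreeGroup.lift_apply_of, mul_inv_eq_one] using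
        sigma_braid (up i) (up j) h
    · simpa only [map_mul, map_inv, FreeGroup.lift_apply_of, mul_inv_eq_one] using
        sigma_comm (up i) (up j) h
    · simpa only [map_mul, map_inv, FreeGroup.lift_apply_of, mul_inv_eq_one] using
        t_comm i.castSucc j.castSucc
    · simpa only [map_mul, map_inv, FreeGroup.lift_apply_of, mul_inv_eq_one, castSucc_swap] using
        t_sigma (up i) j.castSucc
    · simpa only [map_pow, FreeGroup.lift_apply_of] using t_pow j.castSucc)

theorem succ_sigma (i : Fin (n - 1)) : succ d n (sigma i) = sigma (up i) :=
  PresentedGroup.toGroup.of _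

theorem succ_t (j : Fin n) : succ d n (t j) = t j.castSucc :=
  PresentedGroup.toGroup.of _

end Framed

/-! ### The Yokonuma--Hecke algebra -/

/-- The image of an element of `F_{d,n}` in the group algebra `ℂ F_{d,n}`. -/
def grp {d n : ℕ} : Framed d n →* MonoidAlgebra ℂ (Framed d n) :=
  MonoidAlgebra.of ℂ (Framed d n)

/-- The idempotent `e_i = (1/d) ∑_{1 ≤ s ≤ d} t_i^s t_{i+1}^{-s}` of `ℂ F_{d,n}`. -/
def idem (d : ℕ) {n : ℕ} (i : Fin (n - 1)) : MonoidAlgebra ℂ (Framed d n) :=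
  (1 / (d : ℂ)) • ∑ s ∈ Finset.Icc 1 d, grp (Framed.t (lo i) ^ s * (Framed.t (hi i) ^ s)⁻¹)

/-- The quadratic relations `σ_i² = 1 + (q - q⁻¹) e_i σ_i`. -/
inductive QuadRel (d : ℕ) (q : ℂ) (n : ℕ) :
    MonoidAlgebra ℂ (Framed d n) → MonoidAlgebra ℂ (Framed d n) → Prop
  | quad (i : Fin (n - 1)) :
      QuadRel d q n (grp (Framed.sigma i) ^ 2)
        (1 + (q - q⁻¹) • (idem d i * grp (Framed.sigma i)))

/-- The Yokonuma--Hecke algebra `Y_{d,n}(q)`, the quotient of `ℂ F_{d,n}` by the quadratic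
relations. -/
abbrev Y (d : ℕ) (q : ℂ) (n : ℕ) : Type := RingQuot (QuadRel d q n)

namespace Y

/-- The canonical projection `ℂ F_{d,n} → Y_{d,n}(q)`. -/
def proj (d : ℕ) (q : ℂ) (n : ℕ) : MonoidAlgebra ℂ (Framed d n) →ₐ[ℂ] Y d q n :=
  RingQuot.mkAlgHom ℂ (QuadRel d q n)

/-- The image in `Y_{d,n}(q)` of a framed braid. -/
def ofFramed (d : ℕ) (q : ℂ) (n : ℕ) : Framed d n →* Y d q n :=
  (proj d q n : MonoidAlgebra ℂ (Framed d n) →* Y d q n).comp grp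

/-- The image in `Y_{d,n}(q)` of a classical braid, `σ_i ↦ g_i`. -/
def ofBraid (d : ℕ) (q : ℂ) (n : ℕ) : Braid n →* Y d q n :=
  (ofFramed d q n).comp (Framed.ofBraid d n)

/-- The generator `g_i` of `Y_{d,n}(q)`. -/
def g {d : ℕ} {q : ℂ} {n : ℕ} (i : Fin (n - 1)) : Y d q n := ofFramed d q n (Framed.sigma i)

/-- The generator `t_j` of `Y_{d,n}(q)`. -/
def t {d : ℕ} {q : ℂ} {n : ℕ} (j : Fin n) : Y d q n := ofFramed d q n (Framed.t j)

/-- The idempotent `e_i` of `Y_{d,n}(q)`. -/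
def e {d : ℕ} {q : ℂ} {n : ℕ} (i : Fin (n - 1)) : Y d q n := proj d q n (idem d i)

/-- The natural homomorphism `Y_{d,n}(q) → Y_{d,n+1}(q)`, `g_i ↦ g_i`, `t_j ↦ t_j`. -/
def incl (d : ℕ) (q : ℂ) (n : ℕ) : Y d q n →ₐ[ℂ] Y d q (n + 1) :=
  RingQuot.liftAlgHom ℂ
    ⟨MonoidAlgebra.lift ℂ (Y d q (n + 1)) (Framed d n)
      ((ofFramed d q (n + 1)).comp (Framed.succ d n)), by
    have key : ∀ x : Framed d n,
        MonoidAlgebra.lift ℂ (Y d q (n + 1)) (Framed d n)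
          ((ofFramed d q (n + 1)).comp (Framed.succ d n)) (grp x) =
        proj d q (n + 1) (grp (Framed.succ d n x)) := by
      intro x
      simp [grp, ofFramed]
    rintro _ _ ⟨i⟩
    have he : MonoidAlgebra.lift ℂ (Y d q (n + 1)) (Framed d n)
          ((ofFramed d q (n + 1)).comp (Framed.succ d n)) (idem d i) =
        proj d q (n + 1) (idem d (Framed.up i)) := by
      simp only [idem, map_smul, map_sum, key]
      simp only [map_mul, map_inv, map_pow, Framed.succ_t]
      rfl
    have hr : proj d q (n + 1) _ = proj d q (n + 1) _ :=
      RingQuot.mkAlgHom_rel ℂ (QuadRel.quad (d := d) (q := q) (Framed.up i))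
    simp only [map_add, map_mul, map_pow, map_smul, map_one, key, he, Framed.succ_sigma]
    simpa only [map_add, map_mul, map_pow, map_smul, map_one] using hr⟩

end Y

/-! ### The E-system -/

/-- `E^{(m)} = (1/d) ∑_s x_{m+s} x_{-s}`, with indices modulo `d`. -/
def EE {d : ℕ} [NeZero d] (x : ZMod d → ℂ) (m : ZMod d) : ℂ :=
  (1 / (d : ℂ)) * ∑ s : ZMod d, x (m + s) * x (-s)

/-- Solutions of the E-system `E^{(m)} = x_m E^{(0)}` (`m ≠ 0`), with the convention `x_0 = 1`. -/
def IsESolution {d : ℕ} [NeZero d] (x : ZMod d → ℂ) : Prop :=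
  x 0 = 1 ∧ ∀ m : ZMod d, m ≠ 0 → EE x m = x m * EE x 0

/-- The solution `X_D` of the E-system parametrized by `D ⊆ ℤ/dℤ`:
`x_k = (1/|D|) ∑_{m ∈ D} exp(2π√-1 m k / d)`. -/
def XD {d : ℕ} [NeZero d] (D : Finset (ZMod d)) (k : ZMod d) : ℂ :=
  (1 / (D.card : ℂ)) * ∑ m ∈ D, ZMod.stdAddChar (m * k)

/-- `E_D`, the value of `E = E^{(0)}` at the solution `X_D`. -/
def ED {d : ℕ} [NeZero d] (D : Finset (ZMod d)) : ℂ := EE (XD D) 0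

theorem sum_char {d : ℕ} [NeZero d] (a : ZMod d) :
    ∑ s : ZMod d, (ZMod.stdAddChar (a * s) : ℂ) = if a = 0 then (d : ℂ) else 0 := by
  have := AddChar.sum_mulShift a (ZMod.isPrimitive_stdAddChar d)
  simpa [mul_comm] using this

theorem EE_XD {d : ℕ} [NeZero d] (D : Finset (ZMod d)) (m : ZMod d) :
    EE (XD D) m = 1 / (D.card : ℂ) * XD D m := by
  have hd : (d : ℂ) ≠ 0 := Nat.cast_ne_zero.mpr (NeZero.ne d)
  have h : ∑ s : ZMod d, (∑ a ∈ D, (ZMod.stdAddChar (a * (m + s)) : ℂ)) *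
      (∑ b ∈ D, (ZMod.stdAddChar (b * -s) : ℂ)) =
      (d : ℂ) * ∑ a ∈ D, (ZMod.stdAddChar (a * m) : ℂ) := by
    simp_rw [Finset.sum_mul_sum]
    rw [Finset.sum_comm, Finset.mul_sum]
    refine Finset.sum_congr rfl fun a ha => ?_
    rw [Finset.sum_comm]
    have : ∀ b ∈ D, ∑ s : ZMod d, (ZMod.stdAddChar (a * (m + s)) : ℂ) *
        ZMod.stdAddChar (b * -s) =
        if a = b then (d : ℂ) * ZMod.stdAddChar (a * m) else 0 := by
      intro b _
      have : ∀ s : ZMod d, (ZMod.stdAddChar (a * (m + s)) : ℂ) * ZMod.stdAddChar (b * -s) =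
          ZMod.stdAddChar (a * m) * ZMod.stdAddChar ((a - b) * s) := by
        intro s
        rw [← AddChar.map_add_eq_mul, ← AddChar.map_add_eq_mul]
        congr 1
        ring
      simp_rw [this]
      rw [← Finset.mul_sum, sum_char]
      simp [sub_eq_zero, mul_comm]
    rw [Finset.sum_congr rfl this]
    simp [ha]
  have h2 : ∀ s : ZMod d, XD D (m + s) * XD D (-s) =
      (1 / (D.card : ℂ)) ^ 2 * ((∑ a ∈ D, (ZMod.stdAddChar (a * (m + s)) : ℂ)) *
      (∑ b ∈ D, (ZMod.stdAddChar (b * -s) : ℂ))) := by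
    intro s
    simp only [XD]
    ring
  simp only [EE, h2]
  rw [← Finset.mul_sum, h, XD]
  field_simp

theorem XD_zero {d : ℕ} [NeZero d] (D : Finset (ZMod d)) (hD : D.Nonempty) : XD D 0 = 1 := by
  have : (D.card : ℂ) ≠ 0 := Nat.cast_ne_zero.mpr hD.card_pos.ne'
  simp [XD, this]

theorem ED_eq {d : ℕ} [NeZero d] (D : Finset (ZMod d)) (hD : D.Nonempty) :
    ED D = 1 / (D.card : ℂ) := by
  rw [ED, EE_XD, XD_zero D hD, mul_one]

/-- The solutions of the E-system are exactly the `X_D` with `D` non-empty. -/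
theorem isESolution_iff {d : ℕ} [NeZero d] (x : ZMod d → ℂ) :
    IsESolution x ↔ ∃ D : Finset (ZMod d), D.Nonempty ∧ x = XD D := by
  classical
  have hd : (d : ℂ) ≠ 0 := Nat.cast_ne_zero.mpr (NeZero.ne d)
  constructor
  · rintro ⟨h0, h⟩
    have hall : ∀ m, EE x m = x m * EE x 0 := by
      intro m
      by_cases hm : m = 0
      · rw [hm, h0, one_mul]
      · exact h m hm
    set c := EE x 0 with hc
    let y : ZMod d → ℂ := fun a => ∑ k, x k * ZMod.stdAddChar (-(a * k))
    have hy : ∀ a, y a * y a = d * c * y a := by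
      intro a
      have h1 : ∑ m, EE x m * (ZMod.stdAddChar (-(a * m)) : ℂ) = c * y a := by
        simp only [hall, y, Finset.mul_sum]
        exact Finset.sum_congr rfl fun m _ => by ring
      have h2 : ∑ m, EE x m * (ZMod.stdAddChar (-(a * m)) : ℂ) = 1 / d * (y a * y a) := by
        have hyy : y a * y a = ∑ s : ZMod d, ∑ m : ZMod d,
            (x (m + s) * ZMod.stdAddChar (-(a * (m + s)))) *
              (x (-s) * ZMod.stdAddChar (-(a * -s))) := by
          simp only [y]
          rw [Finset.sum_mul_sum, Finset.sum_comm, ← Equiv.sum_comp (Equiv.neg (ZMod d))]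
          exact Finset.sum_congr rfl fun s _ => (Equiv.sum_comp (Equiv.addRight s) _).symm
        rw [hyy, Finset.sum_comm, Finset.mul_sum]
        refine Finset.sum_congr rfl fun m _ => ?_
        rw [EE, mul_assoc, Finset.sum_mul]
        congr 1
        refine Finset.sum_congr rfl fun s _ => ?_
        have : (ZMod.stdAddChar (-(a * m)) : ℂ) =
            ZMod.stdAddChar (-(a * (m + s))) * ZMod.stdAddChar (-(a * -s)) := by
          rw [← AddChar.map_add_eq_mul]
          congr 1
          ring
        rw [this]
        ring
      rw [h2] at h1
      field_simp at h1
      linear_combination h1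
    have hinv : ∀ k, (d : ℂ) * x k = ∑ a, y a * ZMod.stdAddChar (a * k) := by
      intro k
      simp only [y, Finset.sum_mul]
      rw [Finset.sum_comm]
      have : ∀ j : ZMod d, ∑ a : ZMod d, x j * ZMod.stdAddChar (-(a * j)) *
          (ZMod.stdAddChar (a * k) : ℂ) = if j = k then (d : ℂ) * x k else 0 := by
        intro j
        have : ∀ a : ZMod d, x j * ZMod.stdAddChar (-(a * j)) *
            (ZMod.stdAddChar (a * k) : ℂ) = x j * ZMod.stdAddChar ((k - j) * a) := by
          intro a
          rw [mul_assoc, ← AddChar.map_add_eq_mul]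
          congr 2
          ring
        simp_rw [this]
        rw [← Finset.mul_sum, sum_char]
        by_cases hjk : j = k
        · simp [hjk, mul_comm]
        · simp [hjk, sub_eq_zero, Ne.symm hjk]
      simp [this]
    let D : Finset (ZMod d) := Finset.univ.filter fun a => y a ≠ 0
    have hx : ∀ k, x k = c * ∑ a ∈ D, ZMod.stdAddChar (a * k) := by
      intro k
      apply mul_left_cancel₀ hd
      rw [hinv, Finset.mul_sum, Finset.mul_sum, Finset.sum_filter]
      refine Finset.sum_congr rfl fun a _ => ?_
      by_cases ha : y a = 0
      · simp [ha]
      · rw [if_pos ha, mul_right_cancel₀ ha (hy a)]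
        ring
    have hcard : c * D.card = 1 := by
      rw [← h0, hx 0]
      simp
    have hD0 : (D.card : ℂ) ≠ 0 := right_ne_zero_of_mul_eq_one hcard
    refine ⟨D, ?_, ?_⟩
    · rw [← Finset.card_pos]
      exact Nat.pos_of_ne_zero (by exact_mod_cast hD0)
    · funext k
      rw [hx k, XD, eq_one_div_of_mul_eq_one_left hcard]
  · rintro ⟨D, hD, rfl⟩
    refine ⟨XD_zero D hD, fun m _ => ?_⟩
    rw [EE_XD, EE_XD, XD_zero D hD]
    ring

/-! ### The specialized trace -/

/-- The rules of the Markov trace on `⋃_n Y_{d,n}(q)` with values in `ℂ[z]` and framing parameters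
`x_s`. A linear map on the union is a family of linear maps on the `Y_{d,n}(q)` that is compatible
with the natural homomorphisms `Y_{d,n}(q) → Y_{d,n+1}(q)`. -/
structure IsMarkovTrace (d : ℕ) (q : ℂ) (x : ZMod d → ℂ)
    (tr : ∀ n : ℕ, Y d q n →ₗ[ℂ] ℂ[X]) : Prop where
  compat : ∀ (n : ℕ) (a : Y d q n), tr (n + 1) (Y.incl d q n a) = tr n a
  trace : ∀ (n : ℕ) (a b : Y d q n), tr n (a * b) = tr n (b * a)
  one : ∀ n : ℕ, tr n 1 = 1
  markov : ∀ (n : ℕ) (a : Y d q (n + 1)),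
    tr (n + 2) (Y.incl d q (n + 1) a * Y.g ⟨n, by omega⟩) = X * tr (n + 1) a
  framing : ∀ (n : ℕ) (a : Y d q n) (s : ℕ), 1 ≤ s → s ≤ d - 1 →
    tr (n + 1) (Y.incl d q n a * Y.t (Fin.last n) ^ s) = C (x s) * tr n a

/-- The specialized trace `tr_{d,D}` on `⋃_n Y_{d,n}(q)`: the family of linear maps that satisfies
the rules of the Markov trace with framing parameters `X_D`. -/
def tr {d : ℕ} [NeZero d] (D : Finset (ZMod d)) (q : ℂ) : ∀ n : ℕ, Y d q n →ₗ[ℂ] ℂ[X] :=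
  Classical.epsilon (IsMarkovTrace d q (XD D))

/-- `tr_{d,D}(q, z)(α) ∈ ℂ[z]` for a classical braid `α`. -/
def brTr {d : ℕ} [NeZero d] (D : Finset (ZMod d)) (q : ℂ) {n : ℕ} (α : Braid n) : ℂ[X] :=
  tr D q n (Y.ofBraid d q n α)

/-- The change of variables `λ_D = (z - (q - q⁻¹) E_D) / z`. -/
def lamD {d : ℕ} [NeZero d] (D : Finset (ZMod d)) (q z : ℂ) : ℂ :=
  (z - (q - q⁻¹) * ED D) / z

/-- The inverse change of variables `z = (q - q⁻¹) E_D / (1 - λ_D)`. -/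
def zD {d : ℕ} [NeZero d] (D : Finset (ZMod d)) (q lam : ℂ) : ℂ :=
  (q - q⁻¹) * ED D / (1 - lam)

theorem zD_lamD {d : ℕ} [NeZero d] (D : Finset (ZMod d)) (hD : D.Nonempty) (q z : ℂ)
    (hq : q - q⁻¹ ≠ 0) (hz : z ≠ 0) : zD D q (lamD D q z) = z := by
  have hE : ED D ≠ 0 := by
    rw [ED_eq D hD]
    exact one_div_ne_zero (Nat.cast_ne_zero.mpr hD.card_pos.ne')
  have h : 1 - lamD D q z = (q - q⁻¹) * ED D / z := by
    rw [lamD]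
    field_simp
    ring
  rw [zD, h, div_div_cancel₀ (mul_ne_zero hq hE)]

/-- `tr_{d,D}(q, λ_D)(α)`: the trace in the variables `(q, λ_D)`. -/
def brTrLam {d : ℕ} [NeZero d] (D : Finset (ZMod d)) (q lam : ℂ) {n : ℕ} (α : Braid n) : ℂ :=
  (brTr D q α).eval (zD D q lam)

end

end YokonumaHecke

/-!
A Markov trace on the Yokonuma–Hecke algebras is the same as a family of functions on the framed
braid groups that respects the quadratic relations and the Markov and framing rules. Such a family
is unique: every function that respects the quadratic relations on `F_{d,n+1}` is determined by its
values on `a t_{n+1}^s` and `a σ_n b` with `a, b ∈ F_{d,n}`, and the rules express these through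
`F_{d,n}`. The same reduction shows that the values are polynomials in `h = q - q⁻¹` and `z`.

For existence, let `F_{d,n}` act on the `n`-th tensor power of a space with a basis of `N` letters
of each colour in `D`: the crossing acts by the R-matrix of the Hecke algebra on letters of equal
colour and by the flip otherwise, and `t_j` by the character of the colour at `j`. A weighted trace
is a Markov family for one value of `z` for each `q` and `N`. These parameters are Zariski dense, so
the relations hold identically in `(h, z)`.

Finally, `σ_i⁻¹ = σ_i - (q - q⁻¹) e_i`, and the E-condition gives `tr(a e_n) = E_D tr(a)`.
So the mirror image of `tr(q, z)` satisfies the rules for `q⁻¹` and `z - (q - q⁻¹) E_D`,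
and uniqueness yields the identity.
-/

namespace YokonumaHecke

noncomputable section

open Framed

/-! ### Relations in the framed braid group -/

/-- The index of the last braiding generator on `n + 2` strands, which crosses the strands `n` and
`n + 1`. -/
abbrev lastCrossing (n : ℕ) : Fin (n + 2 - 1) := ⟨n, by omega⟩

namespace Framed

variable {d n : ℕ}

theorem induction_on {p : Framed d n → Prop} (x : Framed d n) (one : p 1)
    (sigma : ∀ i, p (sigma i)) (t : ∀ j, p (t j)) (mul : ∀ a b, p a → p b → p (a * b))
    (inv : ∀ a, p a → p a⁻¹) : p x := by
  have hx : x ∈ Subgroup.closure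
      (Set.range (PresentedGroup.of (rels := {r | FramedRel d n r}))) := by
    rw [PresentedGroup.closure_range_of]
    exact Subgroup.mem_top x
  induction hx using Subgroup.closure_induction with
  | mem y hy =>
    obtain ⟨_ | _, rfl⟩ := hy
    · exact sigma _
    · exact t _
  | one => exact one
  | mul a b _ _ ha hb => exact mul a b ha hb
  | inv a _ ha => exact inv a ha

theorem t_inv [NeZero d] (j : Fin n) : (t j : Framed d n)⁻¹ = t j ^ (d - 1) := by
  rw [inv_eq_iff_mul_eq_one, ← pow_succ', Nat.sub_add_cancel NeZero.one_le, t_pow]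

theorem monoid_induction_on [NeZero d] {p : Framed d n → Prop} (x : Framed d n) (one : p 1)
    (sigma : ∀ i, p (sigma i)) (sigma_inv : ∀ i, p (Framed.sigma i)⁻¹) (t : ∀ j, p (t j))
    (mul : ∀ a b, p a → p b → p (a * b)) : p x := by
  suffices h : p x ∧ p x⁻¹ from h.1
  induction x using induction_on with
  | one => simpa using one
  | sigma i => exact ⟨sigma i, sigma_inv i⟩
  | t j =>
    have t_pow (s : ℕ) : p (Framed.t j ^ s) := by
      induction s with
      | zero => simpa using one
      | succ s ih => rw [pow_succ]; exact mul _ _ ih (t j)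
    exact ⟨t j, by rw [t_inv]; exact t_pow _⟩
  | mul a b ha hb => exact ⟨mul _ _ ha.1 hb.1, mul_inv_rev a b ▸ mul _ _ hb.2 ha.2⟩
  | inv a ha => exact ⟨ha.2, (inv_inv a).symm ▸ ha.1⟩

theorem t_pow_inv [NeZero d] (j : Fin n) (s : ℕ) :
    (t j ^ s : Framed d n)⁻¹ = t j ^ ((d - 1) * s) := by
  rw [← inv_pow, t_inv, pow_mul]

instance : Subsingleton (Framed d 0) where
  allEq a b := by
    suffices h : ∀ x : Framed d 0, x = 1 by rw [h a, h b]
    intro x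
    induction x using induction_on with
    | one => rfl
    | sigma i => exact i.elim0
    | t j => exact j.elim0
    | mul a b ha hb => rw [ha, hb, mul_one]
    | inv a ha => rw [ha, inv_one]

/-- The framing `t_i^s t_{i+1}^{-s}`, whose average over `s` is the idempotent `e_i`. -/
def tt (i : Fin (n - 1)) (s : ℕ) : Framed d n := t (lo i) ^ s * (t (hi i) ^ s)⁻¹

theorem succ_tt (i : Fin (n - 1)) (s : ℕ) : succ d n (tt i s) = tt (up i) s := by
  simp only [tt, map_mul, map_inv, map_pow, succ_t]
  rfl

theorem commute_t (i j : Fin n) : Commute (t i : Framed d n) (t j) := t_comm i j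

theorem sigma_semiconj_t_hi (i : Fin (n - 1)) :
    SemiconjBy (sigma i : Framed d n) (t (hi i)) (t (lo i)) := by
  rw [SemiconjBy, t_sigma, Equiv.swap_apply_left]

theorem sigma_semiconj_t_lo (i : Fin (n - 1)) :
    SemiconjBy (sigma i : Framed d n) (t (lo i)) (t (hi i)) := by
  rw [SemiconjBy, t_sigma, Equiv.swap_apply_right]

theorem commute_sigma_t {i : Fin (n - 1)} {j : Fin n} (hlo : j ≠ lo i) (hhi : j ≠ hi i) :
    Commute (sigma i : Framed d n) (t j) := by
  rw [Commute, SemiconjBy, t_sigma, Equiv.swap_apply_of_ne_of_ne hlo hhi]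

theorem commute_t_last_succ (x : Framed d n) : Commute (t (Fin.last n)) (succ d n x) := by
  induction x using induction_on with
  | one => simp
  | sigma i =>
    rw [succ_sigma]
    refine (commute_sigma_t ?_ ?_).symm <;>
    · simp only [lo, hi, up, Fin.last, ne_eq, Fin.mk.injEq]
      omega
  | t j => exact succ_t (d := d) j ▸ commute_t _ _
  | mul a b ha hb => exact map_mul (succ d n) a b ▸ ha.mul_right hb
  | inv a ha => exact map_inv (succ d n) a ▸ ha.inv_right

theorem commute_sigma_succ_succ (x : Framed d n) :
    Commute (sigma (lastCrossing n)) (succ d (n + 1) (succ d n x)) := by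
  induction x using induction_on with
  | one => simp
  | sigma i =>
    rw [succ_sigma, succ_sigma]
    exact (sigma_comm _ _ (by simp only [up]; omega)).symm
  | t j =>
    rw [succ_t, succ_t]
    refine commute_sigma_t ?_ ?_ <;>
    · simp only [lo, hi, ne_eq, Fin.ext_iff, Fin.val_castSucc]
      omega
  | mul a b ha hb => rw [map_mul, map_mul]; exact ha.mul_right hb
  | inv a ha => rw [map_inv, map_inv]; exact ha.inv_right

theorem eq_up_or_last (i : Fin (n + 1 - 1)) : (∃ j : Fin (n - 1), i = up j) ∨ (i : ℕ) + 1 = n := by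
  by_cases h : (i : ℕ) + 1 = n
  · exact .inr h
  · exact .inl ⟨⟨i, by omega⟩, rfl⟩

theorem eq_lastCrossing {i : Fin (n + 2 - 1)} (h : (i : ℕ) + 1 = n + 1) : i = lastCrossing n :=
  Fin.ext (by simpa using h)

theorem sigma_last_mul_t_last_pow (s : ℕ) :
    (sigma (lastCrossing n) * t (Fin.last (n + 1)) ^ s : Framed d (n + 2)) =
      succ d (n + 1) (t (Fin.last n) ^ s) * sigma (lastCrossing n) := by
  rw [map_pow, succ_t]
  exact (sigma_semiconj_t_hi (lastCrossing n)).pow_right s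

theorem t_last_pow_mul_sigma_last (s : ℕ) :
    (t (Fin.last (n + 1)) ^ s * sigma (lastCrossing n) : Framed d (n + 2)) =
      sigma (lastCrossing n) * succ d (n + 1) (t (Fin.last n) ^ s) := by
  rw [map_pow, succ_t]
  exact ((sigma_semiconj_t_lo (lastCrossing n)).pow_right s).symm

theorem tt_lastCrossing (s : ℕ) : (tt (lastCrossing n) s : Framed d (n + 2)) =
    succ d (n + 1) (t (Fin.last n) ^ s) * (t (Fin.last (n + 1)) ^ s)⁻¹ := by
  rw [map_pow, succ_t]
  rfl

theorem succ_mul_sigma_last_mul_succ_mul_t_last_pow (a b : Framed d (n + 1)) (s : ℕ) :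
    succ d (n + 1) a * sigma (lastCrossing n) * succ d (n + 1) b * t (Fin.last (n + 1)) ^ s =
      succ d (n + 1) (a * t (Fin.last n) ^ s) * sigma (lastCrossing n) * succ d (n + 1) b := by
  rw [mul_assoc, ← ((commute_t_last_succ b).pow_left s).eq, mul_assoc (succ d _ a),
    ← mul_assoc (sigma _), sigma_last_mul_t_last_pow, map_mul]
  simp only [mul_assoc]

theorem sigma_last_mul_framing_mul_sigma_last (a : Framed d n) (s : ℕ) :
    sigma (lastCrossing n) * succ d (n + 1) (succ d n a * t (Fin.last n) ^ s) *
        sigma (lastCrossing n) =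
      succ d (n + 1) (succ d n a) * sigma (lastCrossing n) ^ 2 * t (Fin.last (n + 1)) ^ s := by
  rw [map_mul, ← mul_assoc, (commute_sigma_succ_succ a).eq, mul_assoc, ← sigma_last_mul_t_last_pow,
    pow_two]
  simp only [mul_assoc]

theorem sigma_last_mul_braiding_mul_sigma_last {j : Fin (n + 1 - 1)} (hj : (j : ℕ) + 1 = n)
    (a b : Framed d n) :
    sigma (lastCrossing n) * succ d (n + 1) (succ d n a * sigma j * succ d n b) *
        sigma (lastCrossing n) =
      succ d (n + 1) (succ d n a * sigma j) * sigma (lastCrossing n) *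
        succ d (n + 1) (sigma j * succ d n b) := by
  set σ : Framed d (n + 2) := sigma (lastCrossing n)
  set A := succ d (n + 1) (succ d n a)
  set B := succ d (n + 1) (succ d n b)
  have hA : σ * A = A * σ := commute_sigma_succ_succ a
  have hB : σ * B = B * σ := commute_sigma_succ_succ b
  have hσ : sigma (up j) * σ * sigma (up j) = σ * sigma (up j) * σ :=
    sigma_braid (up j) (lastCrossing n) hj
  simp only [map_mul, succ_sigma]
  calc σ * (A * sigma (up j) * B) * σ
    _ = σ * A * sigma (up j) * (B * σ) := by simp only [mul_assoc]
    _ = A * (σ * sigma (up j) * σ) * B := by rw [hA, ← hB]; simp only [mul_assoc]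
    _ = A * sigma (up j) * σ * (sigma (up j) * B) := by rw [← hσ]; simp only [mul_assoc]

theorem tt_lastCrossing_mul_sigma_mul_t_last_pow (r s : ℕ) :
    (tt (lastCrossing n) r * sigma (lastCrossing n) * t (Fin.last (n + 1)) ^ s :
        Framed d (n + 2)) =
      succ d (n + 1) (t (Fin.last n) ^ (r + s)) * sigma (lastCrossing n) *
        succ d (n + 1) (t (Fin.last n) ^ r)⁻¹ := by
  set u := succ d (n + 1) (t (Fin.last n) ^ r)
  set w : Framed d (n + 2) := t (Fin.last (n + 1))
  set σ : Framed d (n + 2) := sigma (lastCrossing n)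
  have hσ : (w ^ r)⁻¹ * σ = σ * u⁻¹ := by
    rw [inv_mul_eq_iff_eq_mul, ← mul_assoc, t_last_pow_mul_sigma_last, mul_inv_cancel_right]
  have hu : u⁻¹ * w ^ s = w ^ s * u⁻¹ := ((commute_t_last_succ _).pow_left s).inv_right.eq.symm
  calc tt (lastCrossing n) r * σ * w ^ s
    _ = u * ((w ^ r)⁻¹ * σ) * w ^ s := by rw [tt_lastCrossing, mul_assoc u]
    _ = u * σ * (u⁻¹ * w ^ s) := by rw [hσ]; simp only [mul_assoc]
    _ = u * (σ * w ^ s) * u⁻¹ := by rw [hu]; simp only [mul_assoc]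
    _ = succ d (n + 1) (t (Fin.last n) ^ (r + s)) * σ * u⁻¹ := by
      rw [sigma_last_mul_t_last_pow, pow_add, map_mul]
      simp only [mul_assoc, σ, u]
    _ = _ := by rw [map_inv]

end Framed

/-! ### Functions that respect the quadratic relations -/

section Quadratic

variable {d n : ℕ} {R M : Type*} [CommRing R] [AddCommGroup M] [Module R M]

/-- The functions on `F_{d,n}` whose linear extensions to the group algebra factor through the
relations `σ_i² = 1 + H ∑_s t_i^s t_{i+1}^{-s} σ_i`. -/
def quadratic (H : R) : Submodule R (Framed d n → M) where
  carrier := {ψ | ∀ (i : Fin (n - 1)) (a b : Framed d n), ψ (a * sigma i ^ 2 * b) =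
    ψ (a * b) + H • ∑ s ∈ Finset.Icc 1 d, ψ (a * tt i s * sigma i * b)}
  zero_mem' := by simp
  add_mem' hφ hψ i a b := by
    simp only [Pi.add_apply, hφ i a b, hψ i a b, Finset.sum_add_distrib, smul_add]
    abel
  smul_mem' c ψ hψ i a b := by
    simp only [Pi.smul_apply, hψ i a b, smul_add, ← Finset.smul_sum, smul_comm c H]

variable {H : R}

theorem mem_quadratic_iff {ψ : Framed d n → M} : ψ ∈ quadratic H ↔
    ∀ (i : Fin (n - 1)) (a b : Framed d n), ψ (a * sigma i ^ 2 * b) =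
      ψ (a * b) + H • ∑ s ∈ Finset.Icc 1 d, ψ (a * tt i s * sigma i * b) :=
  Iff.rfl

theorem mem_quadratic_algebraMap_iff {A : Type*} [CommRing A] [Algebra R A]
    {ψ : Framed d n → A} : ψ ∈ quadratic (algebraMap R A H) ↔ ψ ∈ quadratic H := by
  simp only [mem_quadratic_iff, algebraMap_smul]

theorem comp_mul_left_mul_right_mem_quadratic {ψ : Framed d n → M} (hψ : ψ ∈ quadratic H)
    (x y : Framed d n) : (fun a => ψ (x * a * y)) ∈ quadratic H := by
  intro i a b
  simpa only [mul_assoc] using hψ i (x * a) (b * y)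

theorem comp_mul_right_mem_quadratic {ψ : Framed d n → M} (hψ : ψ ∈ quadratic H)
    (y : Framed d n) : (fun a => ψ (a * y)) ∈ quadratic H := by
  simpa only [one_mul] using comp_mul_left_mul_right_mem_quadratic hψ 1 y

theorem comp_succ_mem_quadratic {ψ : Framed d (n + 1) → M} (hψ : ψ ∈ quadratic H) :
    (fun a => ψ (succ d n a)) ∈ quadratic H := by
  intro i a b
  simpa only [map_mul, map_pow, succ_sigma, succ_tt] using hψ (up i) (succ d n a) (succ d n b)

theorem apply_mul_sigma_inv_mul {ψ : Framed d n → M} (hψ : ψ ∈ quadratic H) (i : Fin (n - 1))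
    (a b : Framed d n) : ψ (a * (sigma i)⁻¹ * b) =
      ψ (a * sigma i * b) - H • ∑ s ∈ Finset.Icc 1 d, ψ (a * tt i s * b) := by
  have h := hψ i a ((sigma i)⁻¹ * b)
  simp only [pow_two, mul_assoc, mul_inv_cancel_left] at h
  simp only [mul_assoc, h, add_sub_cancel_right]

end Quadratic

/-! ### Reduction of the number of strands -/

section Reducible

variable {d n : ℕ} {R M : Type*} [CommRing R] [AddCommGroup M] [Module R M]

/-- The quadratic functions on `F_{d,n+1}` with values in `P` on the framed braids `a t_{n+1}^s` and
`a σ_n b` with `a, b ∈ F_{d,n}`, which span the Yokonuma--Hecke algebra on `n + 1` strands. -/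
def reducible (P : Submodule R M) (H : R) : Submodule R (Framed d (n + 1) → M) :=
  quadratic H ⊓
    (⨅ (a : Framed d n) (s : ℕ), P.comap (LinearMap.proj (succ d n a * t (Fin.last n) ^ s))) ⊓
    ⨅ (i : Fin (n + 1 - 1)) (_ : (i : ℕ) + 1 = n) (a : Framed d n) (b : Framed d n),
      P.comap (LinearMap.proj (succ d n a * sigma i * succ d n b))

variable {P : Submodule R M} {H : R}

theorem mem_reducible_iff {ψ : Framed d (n + 1) → M} : ψ ∈ reducible P H ↔ ψ ∈ quadratic H ∧
    (∀ (a : Framed d n) (s : ℕ), ψ (succ d n a * t (Fin.last n) ^ s) ∈ P) ∧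
    ∀ i : Fin (n + 1 - 1), (i : ℕ) + 1 = n → ∀ a b : Framed d n,
      ψ (succ d n a * sigma i * succ d n b) ∈ P := by
  simp only [reducible, Submodule.mem_inf, Submodule.mem_iInf, Submodule.mem_comap,
    LinearMap.proj_apply, and_assoc]

theorem comp_mul_succ_mem_reducible {ψ : Framed d (n + 1) → M} (hψ : ψ ∈ reducible P H)
    (x : Framed d n) : (fun a => ψ (a * succ d n x)) ∈ reducible P H := by
  obtain ⟨quad, framing, braiding⟩ := mem_reducible_iff.mp hψ
  refine mem_reducible_iff.mpr
    ⟨comp_mul_right_mem_quadratic quad _, fun a s => ?_, fun i hi a b => ?_⟩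
  · rw [mul_assoc, ((commute_t_last_succ x).pow_left s).eq, ← mul_assoc, ← map_mul]
    exact framing _ s
  · rw [mul_assoc, ← map_mul]
    exact braiding i hi _ _

theorem comp_mul_t_last_mem_reducible {ψ : Framed d (n + 1) → M} (hψ : ψ ∈ reducible P H) :
    (fun a => ψ (a * t (Fin.last n))) ∈ reducible P H := by
  obtain ⟨quad, framing, braiding⟩ := mem_reducible_iff.mp hψ
  refine mem_reducible_iff.mpr
    ⟨comp_mul_right_mem_quadratic quad _, fun a s => ?_, fun i hi a b => ?_⟩
  · rw [mul_assoc, ← pow_succ]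
    exact framing _ _
  · obtain ⟨m, rfl⟩ : ∃ m, n = m + 1 := ⟨i, hi.symm⟩
    obtain rfl := eq_lastCrossing hi
    rw [← pow_one (t _), succ_mul_sigma_last_mul_succ_mul_t_last_pow]
    exact braiding _ hi _ _

theorem comp_mul_t_mem_reducible {ψ : Framed d (n + 1) → M} (hψ : ψ ∈ reducible P H)
    (j : Fin (n + 1)) : (fun a => ψ (a * t j)) ∈ reducible P H := by
  induction j using Fin.lastCases with
  | last => exact comp_mul_t_last_mem_reducible hψ
  | cast j => simpa only [succ_t] using comp_mul_succ_mem_reducible hψ (t j)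

theorem comp_mul_t_pow_mem_reducible {ψ : Framed d (n + 1) → M} (hψ : ψ ∈ reducible P H)
    (j : Fin (n + 1)) (s : ℕ) : (fun a => ψ (a * t j ^ s)) ∈ reducible P H := by
  induction s with
  | zero => simpa only [pow_zero, mul_one] using hψ
  | succ s ih => simpa only [pow_succ', mul_assoc] using comp_mul_t_mem_reducible ih j

theorem comp_mul_tt_mem_reducible [NeZero d] {ψ : Framed d (n + 1) → M}
    (hψ : ψ ∈ reducible P H) (i : Fin (n + 1 - 1)) (s : ℕ) :
    (fun a => ψ (a * tt i s)) ∈ reducible P H := by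
  have htt : tt i s = (t (lo i) ^ s * t (hi i) ^ ((d - 1) * s) : Framed d (n + 1)) := by
    rw [tt, t_pow_inv]
  simpa only [htt, mul_assoc] using
    comp_mul_t_pow_mem_reducible (comp_mul_t_pow_mem_reducible hψ (hi i) _) (lo i) s

theorem comp_sigma_mul_succ_mul_sigma_mem_reducible {ψ : Framed d (n + 2) → M}
    (hψ : ψ ∈ reducible P H) (a : Framed d (n + 1)) :
    (fun b => ψ (succ d (n + 1) a * sigma (lastCrossing n) * succ d (n + 1) b *
      sigma (lastCrossing n))) ∈ reducible P H := by
  obtain ⟨quad, framing, braiding⟩ := mem_reducible_iff.mp hψ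
  refine mem_reducible_iff.mpr
    ⟨comp_succ_mem_quadratic (comp_mul_left_mul_right_mem_quadratic quad _ _),
      fun b s => ?_, fun j hj b c => ?_⟩
  · rw [mul_assoc _ (sigma _), mul_assoc, sigma_last_mul_framing_mul_sigma_last, ← mul_assoc,
      ← mul_assoc, ← map_mul, quad]
    refine P.add_mem (framing _ _) (P.smul_mem _ (P.sum_mem fun r _ => ?_))
    rw [mul_assoc, mul_assoc, ← mul_assoc (tt _ _), tt_lastCrossing_mul_sigma_mul_t_last_pow,
      ← mul_assoc, ← mul_assoc, ← map_mul]
    exact braiding _ rfl _ _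
  · rw [mul_assoc _ (sigma _), mul_assoc, sigma_last_mul_braiding_mul_sigma_last hj, ← mul_assoc,
      ← mul_assoc, ← map_mul]
    exact braiding _ rfl _ _

theorem comp_mul_sigma_last_mem_reducible
    (apply_mem : ∀ ψ : Framed d (n + 1) → M, ψ ∈ reducible P H → ∀ x, ψ x ∈ P)
    {ψ : Framed d (n + 2) → M} (hψ : ψ ∈ reducible P H) :
    (fun a => ψ (a * sigma (lastCrossing n))) ∈ reducible P H := by
  obtain ⟨quad, _, braiding⟩ := mem_reducible_iff.mp hψ
  refine mem_reducible_iff.mpr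
    ⟨comp_mul_right_mem_quadratic quad _, fun a s => ?_, fun i hi a b => ?_⟩
  · have h := braiding (lastCrossing n) rfl a (t (Fin.last n) ^ s)
    rwa [mul_assoc, ← t_last_pow_mul_sigma_last, ← mul_assoc] at h
  · obtain rfl := eq_lastCrossing hi
    exact apply_mem _ (comp_sigma_mul_succ_mul_sigma_mem_reducible hψ a) b

theorem comp_mul_mem_reducible [NeZero d]
    (mul_sigma_last : ∀ i : Fin (n + 1 - 1), (i : ℕ) + 1 = n → ∀ ψ : Framed d (n + 1) → M,
      ψ ∈ reducible P H → (fun a => ψ (a * sigma i)) ∈ reducible P H)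
    {ψ : Framed d (n + 1) → M} (hψ : ψ ∈ reducible P H) (x : Framed d (n + 1)) :
    (fun a => ψ (a * x)) ∈ reducible P H := by
  have mul_sigma (i) {ψ : Framed d (n + 1) → M} (hψ : ψ ∈ reducible P H) :
      (fun a => ψ (a * sigma i)) ∈ reducible P H := by
    obtain ⟨j, rfl⟩ | h := eq_up_or_last i
    · simpa only [succ_sigma] using comp_mul_succ_mem_reducible hψ (sigma j)
    · exact mul_sigma_last i h ψ hψ
  induction x using monoid_induction_on generalizing ψ with
  | one => simpa only [mul_one] using hψ
  | sigma i => exact mul_sigma i hψ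
  | sigma_inv i =>
    have h : (fun a => ψ (a * (sigma i)⁻¹)) = (fun a => ψ (a * sigma i)) -
        H • ∑ s ∈ Finset.Icc 1 d, fun a => ψ (a * tt i s) := by
      ext a
      simpa using apply_mul_sigma_inv_mul (mem_reducible_iff.mp hψ).1 i a 1
    rw [h]
    exact Submodule.sub_mem _ (mul_sigma i hψ) (Submodule.smul_mem _ _
      (Submodule.sum_mem _ fun s _ => comp_mul_tt_mem_reducible hψ i s))
  | t j => exact comp_mul_t_mem_reducible hψ j
  | mul x y hx hy => simpa only [mul_assoc] using hx (hy hψ)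

theorem apply_one_mem_of_mem_reducible {ψ : Framed d (n + 1) → M} (hψ : ψ ∈ reducible P H) :
    ψ 1 ∈ P := by
  simpa using (mem_reducible_iff.mp hψ).2.1 1 0

theorem apply_mem_of_mem_reducible [NeZero d] {ψ : Framed d (n + 1) → M}
    (hψ : ψ ∈ reducible P H) (x : Framed d (n + 1)) : ψ x ∈ P := by
  induction n with
  | zero =>
    simpa only [one_mul] using apply_one_mem_of_mem_reducible
      (comp_mul_mem_reducible (fun i hi => by omega) hψ x)
  | succ n ih =>
    refine one_mul x ▸ apply_one_mem_of_mem_reducible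
      (comp_mul_mem_reducible (fun i hi φ hφ => ?_) hψ x)
    obtain rfl := eq_lastCrossing hi
    exact comp_mul_sigma_last_mem_reducible (fun _ => ih) hφ

end Reducible

/-! ### Markov functions -/

theorem sum_Icc_eq_sum_zmod {d : ℕ} [NeZero d] {M : Type*} [AddCommMonoid M] (f : ZMod d → M) :
    ∑ s ∈ Finset.Icc 1 d, f s = ∑ s, f s := by
  have inj : Set.InjOn (Nat.cast : ℕ → ZMod d) (Finset.Icc 1 d) := by
    intro a ha b hb hab
    simp only [Finset.coe_Icc, Set.mem_Icc] at ha hb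
    exact ((ZMod.natCast_eq_natCast_iff a b d).mp hab).eq_of_abs_lt (by rw [abs_lt]; omega)
  have image : (Finset.Icc 1 d).image (Nat.cast : ℕ → ZMod d) = Finset.univ :=
    Finset.eq_univ_of_card _ (by rw [Finset.card_image_of_injOn inj]; simp)
  rw [← image, Finset.sum_image inj]

theorem natCast_pred_mul {d : ℕ} [NeZero d] (s : ℕ) : (((d - 1) * s : ℕ) : ZMod d) = -s := by
  rw [Nat.cast_mul, Nat.cast_pred (NeZero.pos d), CharP.cast_eq_zero]
  ring

/-- The rules of a Markov trace for a family of functions on the framed braid groups with values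
in a commutative ring. The parameter `H` stands for `(q - q⁻¹) / d`. -/
structure IsMarkovFn {d : ℕ} {A : Type*} [CommRing A] (x : ZMod d → A) (H z : A)
    (φ : ∀ n, Framed d n → A) : Prop where
  one : φ 0 1 = 1
  trace : ∀ n (a b : Framed d n), φ n (a * b) = φ n (b * a)
  markov : ∀ n (a : Framed d (n + 1)),
    φ (n + 2) (succ d (n + 1) a * sigma (lastCrossing n)) = z * φ (n + 1) a
  framing : ∀ n (a : Framed d n) (s : ℕ),
    φ (n + 1) (succ d n a * t (Fin.last n) ^ s) = x s * φ n a
  quad : ∀ n, φ n ∈ quadratic H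

namespace IsMarkovFn

variable {d : ℕ} {A B : Type*} [CommRing A] [CommRing B] {x : ZMod d → A} {H z : A}
  {φ φ' : ∀ n, Framed d n → A}

theorem map (hφ : IsMarkovFn x H z φ) (f : A →+* B) :
    IsMarkovFn (fun s => f (x s)) (f H) (f z) fun n a => f (φ n a) where
  one := by rw [hφ.one, map_one]
  trace n a b := by rw [hφ.trace]
  markov n a := by rw [hφ.markov, map_mul]
  framing n a s := by rw [hφ.framing, map_mul]
  quad n i a b := by simp only [hφ.quad n i a b, smul_eq_mul, map_add, map_mul, map_sum]

theorem pi {J : Type*} {x : ZMod d → J → A} {H z : J → A} {φ : J → ∀ n, Framed d n → A}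
    (hφ : ∀ j, IsMarkovFn (fun s => x s j) (H j) (z j) (φ j)) :
    IsMarkovFn x H z fun n a j => φ j n a where
  one := funext fun j => (hφ j).one
  trace n a b := funext fun j => (hφ j).trace n a b
  markov n a := funext fun j => (hφ j).markov n a
  framing n a s := funext fun j => (hφ j).framing n a s
  quad n i a b := funext fun j => by simpa using (hφ j).quad n i a b

theorem succ (hφ : IsMarkovFn x H z φ) (hx : x 0 = 1) (n : ℕ) (a : Framed d n) :
    φ (n + 1) (succ d n a) = φ n a := by
  simpa [hx] using hφ.framing n a 0

theorem apply_one (hφ : IsMarkovFn x H z φ) (hx : x 0 = 1) (n : ℕ) : φ n 1 = 1 := by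
  induction n with
  | zero => exact hφ.one
  | succ n ih => rw [← ih, ← hφ.succ hx n, map_one]

theorem apply_mul_sigma_mul (hφ : IsMarkovFn x H z φ) {n : ℕ} {i : Fin (n + 1 - 1)}
    (hi : (i : ℕ) + 1 = n) (a b : Framed d n) :
    φ (n + 1) (Framed.succ d n a * sigma i * Framed.succ d n b) = z * φ n (b * a) := by
  obtain ⟨m, rfl⟩ : ∃ m, n = m + 1 := ⟨i, hi.symm⟩
  obtain rfl := eq_lastCrossing hi
  rw [hφ.trace, ← mul_assoc, ← map_mul, hφ.markov]

variable [NeZero d]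

theorem unique (hφ : IsMarkovFn x H z φ) (hφ' : IsMarkovFn x H z φ') : φ = φ' := by
  funext n a
  induction n with
  | zero => rw [Subsingleton.elim a 1, hφ.one, hφ'.one]
  | succ n ih =>
    suffices h : φ (n + 1) - φ' (n + 1) ∈ reducible ⊥ H from
      sub_eq_zero.mp ((Submodule.mem_bot A).mp (apply_mem_of_mem_reducible h a))
    refine mem_reducible_iff.mpr ⟨Submodule.sub_mem _ (hφ.quad _) (hφ'.quad _),
      fun b s => ?_, fun i hi b b' => ?_⟩
    · simp only [Submodule.mem_bot, Pi.sub_apply, hφ.framing, hφ'.framing, ih, sub_self]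
    · simp only [Submodule.mem_bot, Pi.sub_apply, hφ.apply_mul_sigma_mul hi,
        hφ'.apply_mul_sigma_mul hi, ih, sub_self]

theorem apply_mem_bot {R : Type*} [CommRing R] [Algebra R A] {x : ZMod d → R} {H z : R}
    (hφ : IsMarkovFn (fun s => algebraMap R A (x s)) (algebraMap R A H) (algebraMap R A z) φ)
    (n : ℕ) (a : Framed d n) : φ n a ∈ (⊥ : Subalgebra R A) := by
  induction n with
  | zero => rw [Subsingleton.elim a 1, hφ.one]; exact one_mem _
  | succ n ih =>
    suffices h : φ (n + 1) ∈ reducible (Subalgebra.toSubmodule ⊥) H from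
      apply_mem_of_mem_reducible h a
    refine mem_reducible_iff.mpr ⟨mem_quadratic_algebraMap_iff.mp (hφ.quad _),
      fun b s => ?_, fun i hi b b' => ?_⟩
    · rw [hφ.framing]
      exact Subalgebra.mul_mem ⊥ (Subalgebra.algebraMap_mem _ _) (ih b)
    · rw [hφ.apply_mul_sigma_mul hi]
      exact Subalgebra.mul_mem ⊥ (Subalgebra.algebraMap_mem _ _) (ih (b' * b))

theorem exists_lift {R : Type*} [CommRing R] {f : R →+* A} (hf : Function.Injective f)
    {x : ZMod d → R} {H z : R} (hφ : IsMarkovFn (fun s => f (x s)) (f H) (f z) φ) :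
    ∃ φ' : ∀ n, Framed d n → R, IsMarkovFn x H z φ' := by
  let := f.toAlgebra
  choose φ' hφ' using fun n a => Algebra.mem_bot.mp (apply_mem_bot (R := R) hφ n a)
  change ∀ n a, f (φ' n a) = φ n a at hφ'
  refine ⟨φ', ⟨hf ?_, fun n a b => hf ?_, fun n a => hf ?_, fun n a s => hf ?_,
    fun n i a b => hf ?_⟩⟩
  · rw [hφ', hφ.one, map_one]
  · rw [hφ', hφ', hφ.trace]
  · rw [hφ', hφ.markov, map_mul, hφ']
  · rw [hφ', hφ.framing, map_mul, hφ']
  · simpa only [map_add, smul_eq_mul, map_mul, map_sum, hφ'] using hφ.quad n i a b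

end IsMarkovFn

/-! ### The E-condition -/

namespace IsMarkovFn

variable {d : ℕ} {A : Type*} [CommRing A] {x : ZMod d → A} {H z c : A}
  {φ : ∀ n, Framed d n → A}

/-- The function `a ↦ ∑_s x_{-s} φ(a t_{n+1}^s) - c φ(a)` on `F_{d,n+1}`, whose vanishing says that
`φ(a e_{n+1}) = (c / d) φ(a)`. -/
def eDefect (x : ZMod d → A) (c : A) (φ : ∀ n, Framed d n → A) (n : ℕ) : Framed d (n + 1) → A :=
  (∑ s ∈ Finset.Icc 1 d, x (-s) • fun a => φ (n + 1) (a * t (Fin.last n) ^ s)) - c • φ (n + 1)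

theorem eDefect_apply (n : ℕ) (a : Framed d (n + 1)) : eDefect x c φ n a =
    ∑ s ∈ Finset.Icc 1 d, x (-s) * φ (n + 1) (a * t (Fin.last n) ^ s) - c * φ (n + 1) a := by
  simp [eDefect]

theorem eDefect_mem_quadratic (hφ : IsMarkovFn x H z φ) (n : ℕ) : eDefect x c φ n ∈ quadratic H :=
  Submodule.sub_mem _ (Submodule.sum_mem _ fun _ _ => Submodule.smul_mem _ _
    (comp_mul_right_mem_quadratic (hφ.quad _) _)) (Submodule.smul_mem _ _ (hφ.quad _))

theorem eDefect_succ_mul_sigma_last_mul_succ (hφ : IsMarkovFn x H z φ) {n : ℕ}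
    (a b : Framed d (n + 1)) :
    eDefect x c φ (n + 1)
        (Framed.succ d (n + 1) a * sigma (lastCrossing n) * Framed.succ d (n + 1) b) =
      z * eDefect x c φ n (b * a) := by
  simp only [eDefect_apply, succ_mul_sigma_last_mul_succ_mul_t_last_pow,
    hφ.apply_mul_sigma_mul (i := lastCrossing n) rfl, mul_sub, Finset.mul_sum, ← mul_assoc b]
  congr 1
  · exact Finset.sum_congr rfl fun s _ => mul_left_comm _ _ _
  · exact mul_left_comm _ _ _

variable [NeZero d]

theorem eDefect_succ_mul_t_last_pow (hφ : IsMarkovFn x H z φ)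
    (hx : ∀ m, ∑ s, x (m + s) * x (-s) = c * x m) {n : ℕ} (a : Framed d n) (r : ℕ) :
    eDefect x c φ n (Framed.succ d n a * t (Fin.last n) ^ r) = 0 := by
  simp only [eDefect_apply, mul_assoc _ (_ ^ r), ← pow_add, hφ.framing, Nat.cast_add]
  rw [sum_Icc_eq_sum_zmod fun s => x (-s) * (x (r + s) * φ n a), ← mul_assoc, ← hx,
    Finset.sum_mul, sub_eq_zero]
  exact Finset.sum_congr rfl fun s _ => by ring

theorem eDefect_eq_zero (hφ : IsMarkovFn x H z φ)
    (hx : ∀ m, ∑ s, x (m + s) * x (-s) = c * x m) {n : ℕ} (a : Framed d (n + 1)) :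
    eDefect x c φ n a = 0 := by
  induction n with
  | zero =>
    refine (Submodule.mem_bot A).mp (apply_mem_of_mem_reducible (mem_reducible_iff.mpr
      ⟨eDefect_mem_quadratic hφ 0, fun b r => ?_, fun i hi => by omega⟩) a)
    exact eDefect_succ_mul_t_last_pow hφ hx b r
  | succ n ih =>
    refine (Submodule.mem_bot A).mp (apply_mem_of_mem_reducible (mem_reducible_iff.mpr
      ⟨eDefect_mem_quadratic hφ _, fun b r => ?_, fun i hi b b' => ?_⟩) a)
    · exact eDefect_succ_mul_t_last_pow hφ hx b r
    · obtain rfl := eq_lastCrossing hi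
      rw [Submodule.mem_bot, eDefect_succ_mul_sigma_last_mul_succ hφ, ih, mul_zero]

theorem apply_succ_mul_tt_last (hφ : IsMarkovFn x H z φ) {n : ℕ} (a : Framed d (n + 1)) (s : ℕ) :
    φ (n + 2) (Framed.succ d (n + 1) a * tt (lastCrossing n) s) =
      x (-s) * φ (n + 1) (a * t (Fin.last n) ^ s) := by
  rw [tt_lastCrossing, ← mul_assoc, ← map_mul, t_pow_inv, hφ.framing, natCast_pred_mul]

theorem sum_apply_succ_mul_tt_last (hφ : IsMarkovFn x H z φ)
    (hx : ∀ m, ∑ s, x (m + s) * x (-s) = c * x m) {n : ℕ} (a : Framed d (n + 1)) :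
    ∑ s ∈ Finset.Icc 1 d, φ (n + 2) (Framed.succ d (n + 1) a * tt (lastCrossing n) s) =
      c * φ (n + 1) a := by
  simp only [hφ.apply_succ_mul_tt_last]
  rw [← sub_eq_zero, ← eDefect_apply, eDefect_eq_zero hφ hx]

theorem sum_apply_tt (hφ : IsMarkovFn x H z φ) (hx₀ : x 0 = 1)
    (hx : ∀ m, ∑ s, x (m + s) * x (-s) = c * x m) {n : ℕ} (i : Fin (n - 1)) :
    ∑ s ∈ Finset.Icc 1 d, φ n (tt i s) = c := by
  induction n with
  | zero => exact i.elim0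
  | succ n ih =>
    obtain ⟨j, rfl⟩ | hi := eq_up_or_last i
    · simpa only [← succ_tt, hφ.succ hx₀] using ih j
    · obtain ⟨m, rfl⟩ : ∃ m, n = m + 1 := ⟨i, hi.symm⟩
      obtain rfl := eq_lastCrossing hi
      simpa [hφ.apply_one hx₀] using hφ.sum_apply_succ_mul_tt_last hx (1 : Framed d (m + 1))

end IsMarkovFn

/-! ### Mirror images -/

theorem Braid.mirror_sigma {n : ℕ} (i : Fin (n - 1)) :
    Braid.mirror n (Braid.sigma i) = (Braid.sigma i)⁻¹ :=
  PresentedGroup.toGroup.of _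

namespace Framed

variable {d n : ℕ}

/-- The endomorphism of `F_{d,n}` with `σ_i ↦ σ_i⁻¹` and `t_j ↦ t_j`. -/
def mirror (d n : ℕ) : Framed d n →* Framed d n :=
  PresentedGroup.toGroup
    (f := fun x => match x with
      | FramedGen.sigma i => (sigma i)⁻¹
      | FramedGen.t j => t j) (by
    rintro r (⟨i, j, h⟩ | ⟨i, j, h⟩ | ⟨i, j⟩ | ⟨i, j⟩ | ⟨j⟩)
    · have := congrArg (·⁻¹) (sigma_braid (d := d) i j h)
      simp only [map_mul, map_inv, FreeGroup.lift_apply_of, mul_inv_eq_one]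
      simpa [mul_assoc] using this
    · have := congrArg (·⁻¹) (sigma_comm (d := d) i j h)
      simp only [map_mul, map_inv, FreeGroup.lift_apply_of, mul_inv_eq_one]
      simpa using this.symm
    · simpa only [map_mul, map_inv, FreeGroup.lift_apply_of, mul_inv_eq_one] using t_comm i j
    · simp only [map_mul, map_inv, FreeGroup.lift_apply_of, mul_inv_eq_one]
      have := t_sigma (d := d) i (Equiv.swap (lo i) (hi i) j)
      rw [Equiv.swap_apply_self] at this
      rw [mul_inv_eq_iff_eq_mul, mul_assoc, this, inv_mul_cancel_left]
    · simpa only [map_pow, FreeGroup.lift_apply_of] using t_pow j)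

theorem mirror_sigma (i : Fin (n - 1)) : mirror d n (sigma i) = (sigma i)⁻¹ :=
  PresentedGroup.toGroup.of _

theorem mirror_t (j : Fin n) : mirror d n (t j) = t j := PresentedGroup.toGroup.of _

theorem mirror_tt (i : Fin (n - 1)) (s : ℕ) : mirror d n (tt i s) = tt i s := by
  simp only [tt, map_mul, map_inv, map_pow, mirror_t]

theorem mirror_succ (x : Framed d n) :
    mirror d (n + 1) (succ d n x) = succ d n (mirror d n x) := by
  induction x using induction_on with
  | one => simp
  | sigma i => rw [succ_sigma, mirror_sigma, mirror_sigma, map_inv, succ_sigma]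
  | t j => rw [succ_t, mirror_t, mirror_t, succ_t]
  | mul a b ha hb => simp only [map_mul, ha, hb]
  | inv a ha => simp only [map_inv, ha]

theorem ofBraid_sigma (i : Fin (n - 1)) : ofBraid d n (Braid.sigma i) = sigma i :=
  PresentedGroup.toGroup.of _

theorem ofBraid_mirror (α : Braid n) :
    ofBraid d n (Braid.mirror n α) = mirror d n (ofBraid d n α) := by
  suffices h : (ofBraid d n).comp (Braid.mirror n) = (mirror d n).comp (ofBraid d n) from
    DFunLike.congr_fun h α
  refine PresentedGroup.ext fun i => ?_
  change ofBraid d n (Braid.mirror n (Braid.sigma i)) = mirror d n (ofBraid d n (Braid.sigma i))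
  rw [Braid.mirror_sigma, map_inv, ofBraid_sigma, mirror_sigma]

end Framed

theorem IsMarkovFn.comp_mirror {d : ℕ} [NeZero d] {A : Type*} [CommRing A] {x : ZMod d → A}
    {H z c : A} {φ : ∀ n, Framed d n → A} (hφ : IsMarkovFn x H z φ)
    (hx : ∀ m, ∑ s, x (m + s) * x (-s) = c * x m) :
    IsMarkovFn x (-H) (z - H * c) fun n a => φ n (mirror d n a) where
  one := by rw [map_one, hφ.one]
  trace n a b := by rw [map_mul, map_mul, hφ.trace]
  markov n a := by
    have h := apply_mul_sigma_inv_mul (hφ.quad (n + 2)) (lastCrossing n)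
      (Framed.succ d (n + 1) (mirror d (n + 1) a)) 1
    simp only [mul_one, smul_eq_mul, hφ.sum_apply_succ_mul_tt_last hx, hφ.markov] at h
    rw [map_mul, mirror_sigma, mirror_succ, h]
    ring
  framing n a s := by rw [map_mul, mirror_succ, map_pow, mirror_t, hφ.framing]
  quad n i a b := by
    have h := apply_mul_sigma_inv_mul (hφ.quad n) i (mirror d n a) ((sigma i)⁻¹ * mirror d n b)
    simp only [mul_assoc, mul_inv_cancel_left, smul_eq_mul] at h
    simp only [pow_two, map_mul, mirror_sigma, mirror_tt, mul_assoc, smul_eq_mul, h]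
    ring

/-! ### The coloured R-matrix -/

section Words

variable {P L : Type*} [DecidableEq P]

theorem comp_swap_comp_swap (w : P → L) (k l : P) :
    (w ∘ Equiv.swap k l) ∘ Equiv.swap k l = w := by
  rw [Function.comp_assoc, ← Equiv.coe_trans, Equiv.swap_swap, Equiv.coe_refl, Function.comp_id]

theorem comp_swap_of_eq {w : P → L} {k l : P} (h : w k = w l) : w ∘ Equiv.swap k l = w := by
  rw [Equiv.comp_swap_eq_update, h, Function.update_eq_self, ← h, Function.update_eq_self]

/-- The word `w` with its letters at the positions `k`, `l`, `m` replaced by `a`, `b`, `c`. -/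
def replace (w : P → L) (k l m : P) (a b c : L) : P → L :=
  Function.update (Function.update (Function.update w m c) l b) k a

variable {k l m : P}

theorem replace_comp_swap_left (hkl : k ≠ l) (w : P → L) (a b c : L) :
    replace w k l m a b c ∘ Equiv.swap k l = replace w k l m b a c := by
  ext1 j
  simp only [replace, Function.comp_apply, Function.update_apply, Equiv.swap_apply_def]
  grind

theorem replace_comp_swap_right (hkl : k ≠ l) (hlm : l ≠ m) (hkm : k ≠ m) (w : P → L)
    (a b c : L) : replace w k l m a b c ∘ Equiv.swap l m = replace w k l m a c b := by
  ext1 j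
  simp only [replace, Function.comp_apply, Function.update_apply, Equiv.swap_apply_def]
  grind

theorem replace_left (w : P → L) (a b c : L) : replace w k l m a b c k = a := by
  simp [replace]

theorem replace_middle (hkl : k ≠ l) (w : P → L) (a b c : L) : replace w k l m a b c l = b := by
  simp [replace, hkl.symm]

theorem replace_right (hlm : l ≠ m) (hkm : k ≠ m) (w : P → L) (a b c : L) :
    replace w k l m a b c m = c := by
  simp [replace, hkm.symm, hlm.symm]

theorem replace_self (w : P → L) : replace w k l m (w k) (w l) (w m) = w := by
  simp [replace]

end Words

section RMatrix

variable {𝕜 κ ι P : Type*} [Field 𝕜] [DecidableEq κ] [DecidableEq P]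

/-- The diagonal operators on the functions on words. -/
def diag (𝕜 W : Type*) [Field 𝕜] : (W → 𝕜) →ₐ[𝕜] Module.End 𝕜 (W → 𝕜) := Algebra.lmul 𝕜 _

theorem diag_apply {W : Type*} (u f : W → 𝕜) (w : W) : diag 𝕜 W u f w = u w * f w := rfl

/-- The indicator function of the words with letters of the same colour at `k` and `l`. -/
def sameColour (k l : P) : (P → κ × ι) → 𝕜 := fun w => if (w k).1 = (w l).1 then 1 else 0

theorem sameColour_comp_swap (k l : P) (w : P → κ × ι) :
    (sameColour k l (w ∘ Equiv.swap k l) : 𝕜) = sameColour k l w := by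
  simp [sameColour, eq_comm]

variable [LinearOrder ι]

/-- The entry of the R-matrix that interchanges the letters `a` and `b`, where a letter is a pair
of a colour and an index. -/
def swapCoeff (q : 𝕜) (a b : κ × ι) : 𝕜 := if a = b then q else 1

/-- The diagonal entry of the R-matrix at distinct letters `a` and `b`. -/
def stayCoeff (q : 𝕜) (a b : κ × ι) : 𝕜 := if a.1 = b.1 ∧ b.2 < a.2 then q - q⁻¹ else 0

theorem swapCoeff_self (q : 𝕜) (a : κ × ι) : swapCoeff q a a = q := if_pos rfl

theorem swapCoeff_of_ne (q : 𝕜) {a b : κ × ι} (h : a ≠ b) : swapCoeff q a b = 1 := if_neg h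

theorem stayCoeff_self (q : 𝕜) (a : κ × ι) : stayCoeff q a a = 0 := by
  simp [stayCoeff]

theorem stayCoeff_sq (q : 𝕜) (a b : κ × ι) :
    stayCoeff q a b ^ 2 = (q - q⁻¹) * stayCoeff q a b := by
  unfold stayCoeff
  split_ifs <;> ring

theorem stayCoeff_mul_stayCoeff_swap (q : 𝕜) (a b : κ × ι) :
    stayCoeff q a b * stayCoeff q b a = 0 := by
  unfold stayCoeff
  grind

theorem stayCoeff_add_stayCoeff_swap (q : 𝕜) {a b : κ × ι} (h : a ≠ b) :
    stayCoeff q a b + stayCoeff q b a = (q - q⁻¹) * if a.1 = b.1 then 1 else 0 := by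
  unfold stayCoeff
  grind

theorem stayCoeff_rel_left (q : 𝕜) {a b : κ × ι} (h : a ≠ b) (c : κ × ι) :
    stayCoeff q a c * stayCoeff q b a + stayCoeff q a b * stayCoeff q b c =
      stayCoeff q b c * stayCoeff q a c := by
  unfold stayCoeff
  grind

theorem stayCoeff_rel_right (q : 𝕜) (a : κ × ι) {b c : κ × ι} (h : b ≠ c) :
    stayCoeff q a b * stayCoeff q a c =
      stayCoeff q a c * stayCoeff q c b + stayCoeff q b c * stayCoeff q a b := by
  unfold stayCoeff
  grind

theorem yangBaxter {q : 𝕜} (hq : q ≠ 0) (F : κ × ι → κ × ι → κ × ι → 𝕜) (a b c : κ × ι) :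
    let γ : κ × ι → κ × ι → 𝕜 := swapCoeff q
    let β : κ × ι → κ × ι → 𝕜 := stayCoeff q
    γ a b * (γ a c * (γ b c * F c b a + β b c * F b c a) +
        β a c * (γ b a * F a b c + β b a * F b a c)) +
      β a b * (γ b c * (γ a c * F c a b + β a c * F a c b) +
        β b c * (γ a b * F b a c + β a b * F a b c)) =
    γ b c * (γ a c * (γ a b * F c b a + β a b * F c a b) +
        β a c * (γ c b * F a b c + β c b * F a c b)) +
      β b c * (γ a b * (γ a c * F b c a + β a c * F b a c) +
        β a b * (γ b c * F a c b + β b c * F a b c)) := by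
  intro γ β
  have β_sq : ∀ a b, β a b ^ 2 = (q - q⁻¹) * β a b := stayCoeff_sq q
  have β_mul_swap : ∀ a b, β a b * β b a = 0 := stayCoeff_mul_stayCoeff_swap q
  have γ_self : ∀ a, γ a a = q := swapCoeff_self q
  have β_self : ∀ a, β a a = 0 := stayCoeff_self q
  have γ_ne {a b} (h : a ≠ b) : γ a b = 1 ∧ γ b a = 1 :=
    ⟨swapCoeff_of_ne q h, swapCoeff_of_ne q h.symm⟩
  have q_mul : q * (q - q⁻¹) = q ^ 2 - 1 := by field_simp
  clear_value γ
  rcases eq_or_ne a b with rfl | hab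
  · rcases eq_or_ne a c with rfl | hac
    · rfl
    simp only [γ_self, β_self, γ_ne hac]
    linear_combination (-(q * F a a c)) * β_sq a c - β a c * F a a c * q_mul
      - β_mul_swap a c * F a c a
  rcases eq_or_ne b c with rfl | hbc
  · simp only [γ_self, β_self, γ_ne hab]
    linear_combination (q * F a b b) * β_sq a b + β a b * F a b b * q_mul
      + β_mul_swap a b * F b a b
  have left : β a c * β b a + β a b * β b c = β b c * β a c := stayCoeff_rel_left q hab c
  have right : β a b * β a c = β a c * β c b + β b c * β a b := stayCoeff_rel_right q a hbc
  rcases eq_or_ne a c with rfl | hac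
  · simp only [γ_self, β_self, γ_ne hab] at left right ⊢
    linear_combination F b a a * left + F a a b * right +
      F a b a * (β b a * β_sq a b - β a b * β_sq b a)
  · simp only [γ_ne hab, γ_ne hac, γ_ne hbc]
    linear_combination F b a c * left + F a c b * right +
      F a b c * (β b c * β_sq a b - β a b * β_sq b c)

/-- The R-matrix acting at the positions `k` and `l` of the functions on words. -/
def rOp (q : 𝕜) (k l : P) : Module.End 𝕜 ((P → κ × ι) → 𝕜) where
  toFun f w := swapCoeff q (w k) (w l) * f (w ∘ Equiv.swap k l) + stayCoeff q (w k) (w l) * f w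
  map_add' f g := by ext w; simp only [Pi.add_apply]; ring
  map_smul' c f := by ext w; simp only [Pi.smul_apply, smul_eq_mul, RingHom.id_apply]; ring

theorem rOp_apply (q : 𝕜) (k l : P) (f : (P → κ × ι) → 𝕜) (w : P → κ × ι) :
    rOp q k l f w =
      swapCoeff q (w k) (w l) * f (w ∘ Equiv.swap k l) + stayCoeff q (w k) (w l) * f w := rfl

theorem rOp_mul_self {q : 𝕜} (hq : q ≠ 0) (k l : P) :
    (rOp q k l * rOp q k l : Module.End 𝕜 ((P → κ × ι) → 𝕜)) =
      1 + (q - q⁻¹) • (diag 𝕜 _ (sameColour k l) * rOp q k l) := by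
  refine LinearMap.ext fun f => funext fun w => ?_
  simp only [Module.End.mul_apply, LinearMap.add_apply, LinearMap.smul_apply, Module.End.one_apply,
    Pi.add_apply, Pi.smul_apply, smul_eq_mul, diag_apply, rOp_apply, comp_swap_comp_swap,
    sameColour, Function.comp_apply, Equiv.swap_apply_left, Equiv.swap_apply_right]
  by_cases h : w k = w l
  · rw [comp_swap_of_eq h, h]
    simp only [swapCoeff_self, stayCoeff_self, if_true]
    field_simp
    ring
  · rw [swapCoeff_of_ne q h, swapCoeff_of_ne q (Ne.symm h)]
    have hsum := stayCoeff_add_stayCoeff_swap q h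
    have hmul := stayCoeff_mul_stayCoeff_swap q (w k) (w l)
    linear_combination (f (w ∘ Equiv.swap k l) + stayCoeff q (w k) (w l) * f w) * hsum - f w * hmul

theorem commute_diag_rOp (q : 𝕜) {k l : P} {u : (P → κ × ι) → 𝕜}
    (hu : ∀ w, u (w ∘ Equiv.swap k l) = u w) : Commute (diag 𝕜 _ u) (rOp q k l) := by
  refine LinearMap.ext fun f => funext fun w => ?_
  simp only [Module.End.mul_apply, diag_apply, rOp_apply, hu]
  ring

theorem rOp_braid {q : 𝕜} (hq : q ≠ 0) {k l m : P} (hkl : k ≠ l) (hlm : l ≠ m) (hkm : k ≠ m) :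
    (rOp q k l * rOp q l m * rOp q k l : Module.End 𝕜 ((P → κ × ι) → 𝕜)) =
      rOp q l m * rOp q k l * rOp q l m := by
  refine LinearMap.ext fun f => funext fun w => ?_
  rw [← replace_self (k := k) (l := l) (m := m) w]
  simp only [Module.End.mul_apply, rOp_apply, replace_comp_swap_left hkl,
    replace_comp_swap_right hkl hlm hkm, replace_left, replace_middle hkl, replace_right hlm hkm]
  exact yangBaxter hq (fun a b c => f (replace w k l m a b c)) (w k) (w l) (w m)

theorem commute_rOp_rOp (q : 𝕜) {k l k' l' : P} (hkk' : k ≠ k') (hkl' : k ≠ l') (hlk' : l ≠ k')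
    (hll' : l ≠ l') :
    Commute (rOp q k l : Module.End 𝕜 ((P → κ × ι) → 𝕜)) (rOp q k' l') := by
  refine LinearMap.ext fun f => funext fun w => ?_
  have swaps : (w ∘ Equiv.swap k l) ∘ Equiv.swap k' l' =
      (w ∘ Equiv.swap k' l') ∘ Equiv.swap k l := by
    ext1 j
    simp only [Function.comp_apply, Equiv.swap_apply_def]
    grind
  simp only [Module.End.mul_apply, rOp_apply, swaps, Function.comp_apply,
    Equiv.swap_apply_of_ne_of_ne hkk' hkl', Equiv.swap_apply_of_ne_of_ne hlk' hll',
    Equiv.swap_apply_of_ne_of_ne hkk'.symm hlk'.symm,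
    Equiv.swap_apply_of_ne_of_ne hkl'.symm hll'.symm]
  ring

end RMatrix

/-! ### Partial traces on tensor space -/

section PartialTrace

variable {𝕜 L : Type*} [Field 𝕜] {n : ℕ}

/-- The weight of a word, the product of the weights `μ` of its letters. -/
def weight (μ : L → 𝕜) (n : ℕ) : (Fin n → L) → 𝕜 := fun w => ∏ j, μ (w j)

theorem weight_snoc (μ : L → 𝕜) (w : Fin n → L) (a : L) :
    weight μ (n + 1) (Fin.snoc w a) = weight μ n w * μ a := by
  simp [weight, Fin.prod_univ_castSucc]

/-- The restriction of a function to the words ending in `a`. -/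
def restrict (a : L) : ((Fin (n + 1) → L) → 𝕜) →ₗ[𝕜] (Fin n → L) → 𝕜 :=
  LinearMap.funLeft 𝕜 𝕜 fun w => Fin.snoc w a

theorem restrict_apply (a : L) (f : (Fin (n + 1) → L) → 𝕜) (w : Fin n → L) :
    restrict a f w = f (Fin.snoc w a) := rfl

theorem snoc_comp_swap_castSucc (w : Fin n → L) (a : L) (k l : Fin n) :
    (Fin.snoc w a : Fin (n + 1) → L) ∘ Equiv.swap k.castSucc l.castSucc =
      Fin.snoc (w ∘ Equiv.swap k l) a := by
  funext j
  induction j using Fin.lastCases with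
  | last =>
    rw [Function.comp_apply,
      Equiv.swap_apply_of_ne_of_ne (Fin.castSucc_ne_last k).symm (Fin.castSucc_ne_last l).symm]
    simp
  | cast j =>
    rw [Function.comp_apply, (Fin.castSucc_injective n).swap_apply]
    simp

variable [DecidableEq L]

theorem single_snoc_apply_snoc (v w : Fin n → L) (a : L) :
    (Pi.single (Fin.snoc v a) 1 : (Fin (n + 1) → L) → 𝕜) (Fin.snoc w a) =
      if w = v then 1 else 0 := by
  simp only [Pi.single_apply, Fin.snoc_inj, and_true]

theorem diag_single {W : Type*} [DecidableEq W] (u : W → 𝕜) (w : W) :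
    diag 𝕜 W u (Pi.single w 1) = u w • Pi.single w 1 := by
  funext v
  rw [diag_apply, Pi.smul_apply, smul_eq_mul]
  obtain rfl | h := eq_or_ne v w
  · rfl
  · simp [Pi.single_eq_of_ne h]

theorem trace_eq_sum_apply_single {W : Type*} [Fintype W] [DecidableEq W]
    (A : Module.End 𝕜 (W → 𝕜)) : LinearMap.trace 𝕜 _ A = ∑ w, A (Pi.single w 1) w := by
  simp [LinearMap.trace_eq_matrix_trace 𝕜 (Pi.basisFun 𝕜 W), Matrix.trace]

variable [Fintype L] {μ : L → 𝕜} {c : 𝕜}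

theorem trace_mul_mul_diag_weight_succ {A : Module.End 𝕜 ((Fin n → L) → 𝕜)}
    {A' B : Module.End 𝕜 ((Fin (n + 1) → L) → 𝕜)}
    (hA : ∀ a, restrict a ∘ₗ A' = A ∘ₗ restrict a)
    (hB : ∀ v w : Fin n → L,
      ∑ a, μ a * B (Pi.single (Fin.snoc v a) 1) (Fin.snoc w a) = if w = v then c else 0) :
    LinearMap.trace 𝕜 _ (A' * B * diag 𝕜 _ (weight μ (n + 1))) =
      c * LinearMap.trace 𝕜 _ (A * diag 𝕜 _ (weight μ n)) := by
  have apply_snoc (f v a) : A' f (Fin.snoc v a) = A (restrict a f) v :=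
    congrFun (LinearMap.congr_fun (hA a) f) v
  have partial_trace (v : Fin n → L) :
      ∑ a, μ a • restrict a (B (Pi.single (Fin.snoc v a) 1)) = c • Pi.single v 1 := by
    funext w
    simpa [Pi.single_apply, restrict_apply] using hB v w
  rw [trace_eq_sum_apply_single, trace_eq_sum_apply_single, Finset.mul_sum,
    ← (Fin.snocEquiv fun _ => L).sum_comp, Fintype.sum_prod_type_right]
  refine Finset.sum_congr rfl fun v _ => ?_
  simp only [Fin.snocEquiv, Equiv.coe_fn_mk, Module.End.mul_apply, diag_single, map_smul,
    Pi.smul_apply, smul_eq_mul, weight_snoc, apply_snoc]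
  have h := congrArg (fun f => A f v) (partial_trace v)
  simp only [map_sum, map_smul, Finset.sum_apply, Pi.smul_apply, smul_eq_mul] at h
  rw [mul_left_comm, ← h, Finset.mul_sum]
  exact Finset.sum_congr rfl fun a _ => mul_assoc _ _ _

theorem partial_trace_diag {u : (Fin (n + 1) → L) → 𝕜}
    (hu : ∀ w : Fin n → L, ∑ a, μ a * u (Fin.snoc w a) = c) (v w : Fin n → L) :
    ∑ a, μ a * diag 𝕜 _ u (Pi.single (Fin.snoc v a) 1) (Fin.snoc w a) =
      if w = v then c else 0 := by
  simp only [diag_apply, single_snoc_apply_snoc, ← mul_assoc, ← Finset.sum_mul, hu]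
  rw [mul_ite, mul_one, mul_zero]

end PartialTrace

section PartialTraceRMatrix

variable {𝕜 κ ι : Type*} [Field 𝕜] [DecidableEq κ] [LinearOrder ι] {n : ℕ}

theorem restrict_comp_rOp (q : 𝕜) (k l : Fin n) (a : κ × ι) :
    restrict a ∘ₗ rOp q k.castSucc l.castSucc = rOp q k l ∘ₗ restrict a := by
  refine LinearMap.ext fun f => funext fun w => ?_
  simp only [LinearMap.comp_apply, restrict_apply, rOp_apply, snoc_comp_swap_castSucc,
    Fin.snoc_castSucc]

theorem swapCoeff_mul_single_snoc_swap (q : 𝕜) (v w : Fin (n + 1) → κ × ι) (a : κ × ι) :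
    swapCoeff q (w (Fin.last n)) a * (Pi.single (Fin.snoc v a) 1 : (Fin (n + 2) → κ × ι) → 𝕜)
      ((Fin.snoc w a : Fin (n + 2) → κ × ι) ∘
        Equiv.swap (Fin.last n).castSucc (Fin.last (n + 1))) =
      if w (Fin.last n) = a then q * (if w = v then 1 else 0) else 0 := by
  by_cases ha : w (Fin.last n) = a
  · rw [comp_swap_of_eq (by simpa using ha), single_snoc_apply_snoc, if_pos ha, ha,
      swapCoeff_self]
  · have hne : (Fin.snoc w a : Fin (n + 2) → κ × ι) ∘
        Equiv.swap (Fin.last n).castSucc (Fin.last (n + 1)) ≠ Fin.snoc v a := fun h =>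
      ha (by simpa using congrFun h (Fin.last (n + 1)))
    rw [if_neg ha, Pi.single_eq_of_ne hne, mul_zero]

variable [Fintype κ] [Fintype ι]

theorem partial_trace_rOp {q : 𝕜} {μ : κ × ι → 𝕜} {c : 𝕜}
    (hμ : ∀ b, q * μ b + ∑ a, stayCoeff q b a * μ a = c) (v w : Fin (n + 1) → κ × ι) :
    ∑ a, μ a * rOp q (Fin.last n).castSucc (Fin.last (n + 1))
        (Pi.single (Fin.snoc v a) 1) (Fin.snoc w a : Fin (n + 2) → κ × ι) =
      if w = v then c else 0 := by
  simp only [rOp_apply, Fin.snoc_castSucc, Fin.snoc_last, swapCoeff_mul_single_snoc_swap,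
    single_snoc_apply_snoc]
  split_ifs with h
  · simp only [← hμ (w (Fin.last n)), mul_one, mul_add, mul_ite, mul_zero,
      Finset.sum_add_distrib, Finset.sum_ite_eq, Finset.mem_univ, if_true]
    simp only [mul_comm]
  · simp

end PartialTraceRMatrix

/-! ### The Markov trace on tensor space -/

section LetterWeight

variable {𝕜 κ : Type*} [Field 𝕜] {N : ℕ} {q : 𝕜}

/-- The weight of the first of the `N` letters of a colour, normalised so that the weights of the
letters of `m` colours, which decrease by the factor `q⁻²` along each colour, sum to `1`. -/
def baseWeight (m N : ℕ) (q : 𝕜) : 𝕜 := (m : 𝕜)⁻¹ * ((1 - q⁻¹ ^ 2) / (1 - (q⁻¹ ^ 2) ^ N))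

/-- The weights of the letters for the Markov trace. -/
def letterWeight [Fintype κ] (q : 𝕜) (a : κ × Fin N) : 𝕜 :=
  baseWeight (Fintype.card κ) N q * (q⁻¹ ^ 2) ^ (a.2 : ℕ)

variable [Fintype κ]

theorem sum_letterWeight (hN : (q⁻¹ ^ 2) ^ N ≠ 1) (c : κ) :
    ∑ k : Fin N, letterWeight q (c, k) = (Fintype.card κ : 𝕜)⁻¹ := by
  simp only [letterWeight, baseWeight]
  rw [← Finset.mul_sum, Fin.sum_univ_eq_sum_range fun k => (q⁻¹ ^ 2) ^ k, mul_assoc,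
    div_mul_eq_mul_div, mul_neg_geom_sum, div_self (sub_ne_zero.mpr hN.symm), mul_one]

theorem sum_letterWeight_mul (hN : (q⁻¹ ^ 2) ^ N ≠ 1) (f : κ → 𝕜) :
    ∑ a : κ × Fin N, letterWeight q a * f a.1 = (Fintype.card κ : 𝕜)⁻¹ * ∑ c, f c := by
  rw [Fintype.sum_prod_type, Finset.mul_sum]
  simp only [← Finset.sum_mul, sum_letterWeight hN]

theorem sum_stayCoeff_mul_letterWeight [DecidableEq κ] (b : κ × Fin N) :
    ∑ a, stayCoeff q b a * letterWeight q a = (q - q⁻¹) * baseWeight (Fintype.card κ) N q *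
      ∑ k ∈ Finset.range b.2, (q⁻¹ ^ 2) ^ k := by
  have support (c : κ) (k : Fin N) : stayCoeff q b (c, k) * letterWeight q (c, k) =
      if b.1 = c then if k < b.2 then
        (q - q⁻¹) * baseWeight (Fintype.card κ) N q * (q⁻¹ ^ 2) ^ (k : ℕ) else 0 else 0 := by
    simp only [stayCoeff, letterWeight]
    split_ifs <;> simp_all [mul_assoc]
  simp only [Fintype.sum_prod_type, support, Finset.sum_ite_irrel, Finset.sum_const_zero,
    Finset.sum_ite_eq, Finset.mem_univ, if_true]
  rw [Finset.mul_sum, ← Finset.sum_filter, Finset.filter_gt_eq_Iio, ← Nat.Iio_eq_range,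
    ← Fin.map_valEmbedding_Iio, Finset.sum_map]
  rfl

theorem letterWeight_rel [DecidableEq κ] (hq : q ≠ 0) (b : κ × Fin N) :
    q * letterWeight q b + ∑ a, stayCoeff q b a * letterWeight q a =
      q * baseWeight (Fintype.card κ) N q := by
  have hq' : q - q⁻¹ = q * (1 - q⁻¹ ^ 2) := by field_simp
  rw [sum_stayCoeff_mul_letterWeight, hq', letterWeight]
  linear_combination q * baseWeight (Fintype.card κ) N q * mul_neg_geom_sum (q⁻¹ ^ 2) (b.2 : ℕ)

end LetterWeight

section Representation

theorem comp_map_inv_eq_of_comp_map_eq {𝕜 G V W : Type*} [Field 𝕜] [Group G] [AddCommGroup V]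
    [Module 𝕜 V] [AddCommGroup W] [Module 𝕜 W] {ρ : Representation 𝕜 G V}
    {σ : Representation 𝕜 G W} {f : V →ₗ[𝕜] W} {x : G} (h : f ∘ₗ ρ x = σ x ∘ₗ f) :
    f ∘ₗ ρ x⁻¹ = σ x⁻¹ ∘ₗ f := by
  ext v
  have hv := LinearMap.congr_fun h (ρ x⁻¹ v)
  simp only [LinearMap.comp_apply, ρ.self_inv_apply] at hv ⊢
  rw [hv, σ.inv_self_apply]

variable {d : ℕ} [NeZero d] {D : Finset (ZMod d)} {N n : ℕ}

/-- The functions on the words of length `n` in `N` letters of each colour in `D`, a model of the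
`n`-th tensor power of the functions on the letters. -/
abbrev WordFn (D : Finset (ZMod d)) (N n : ℕ) : Type := (Fin n → D × Fin N) → ℂ

/-- The `d`-th root of unity attached to the colour of the letter at `k`. -/
def colourChar (k : Fin n) : WordFn D N n := fun w => ZMod.stdAddChar ((w k).1 : ZMod d)

theorem colourChar_pow_apply (k : Fin n) (s : ℕ) (w : Fin n → D × Fin N) :
    (colourChar k ^ s : WordFn D N n) w = ZMod.stdAddChar (((w k).1 : ZMod d) * (s : ZMod d)) := by
  rw [Pi.pow_apply, colourChar, ← AddChar.map_nsmul_eq_pow, nsmul_eq_mul, mul_comm]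

theorem colourChar_pow_card (k : Fin n) : (colourChar k : WordFn D N n) ^ d = 1 := by
  funext w
  rw [colourChar_pow_apply, CharP.cast_eq_zero, mul_zero, AddChar.map_zero_eq_one, Pi.one_apply]

theorem diag_colourChar_mul_rOp (q : ℂ) (k l j : Fin n) :
    diag ℂ (Fin n → D × Fin N) (colourChar j) * rOp q k l =
      rOp q k l * diag ℂ _ (colourChar (Equiv.swap k l j)) := by
  refine LinearMap.ext fun f => funext fun w => ?_
  simp only [Module.End.mul_apply, diag_apply, rOp_apply, colourChar, Function.comp_apply,
    Equiv.swap_apply_self]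
  by_cases h : (w k).1 = (w l).1
  · have colour : (w (Equiv.swap k l j)).1 = (w j).1 := by
      rw [Equiv.swap_apply_def]
      split_ifs <;> simp_all
    rw [colour]
    ring
  · simp only [stayCoeff, h, false_and, if_false]
    ring

/-- The R-matrix as an invertible operator. -/
def rUnit {q : ℂ} (hq : q ≠ 0) (k l : Fin n) : (Module.End ℂ (WordFn D N n))ˣ where
  val := rOp q k l
  inv := rOp q k l - (q - q⁻¹) • diag ℂ _ (sameColour k l)
  val_inv := by
    rw [mul_sub, rOp_mul_self hq, mul_smul_comm,
      ← (commute_diag_rOp q (sameColour_comp_swap k l)).eq, add_sub_cancel_right]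
  inv_val := by rw [sub_mul, rOp_mul_self hq, smul_mul_assoc, add_sub_cancel_right]

/-- The multiplication by the colour character at `k` as an invertible operator. -/
def tUnit (D : Finset (ZMod d)) (N : ℕ) (k : Fin n) : (Module.End ℂ (WordFn D N n))ˣ :=
  Units.map (diag ℂ (Fin n → D × Fin N) : WordFn D N n →* Module.End ℂ (WordFn D N n))
    (Units.ofPowEqOne (colourChar k) d (colourChar_pow_card k) (NeZero.ne d))

theorem val_tUnit (k : Fin n) : (tUnit D N k : Module.End ℂ (WordFn D N n)) =
    diag ℂ _ (colourChar k) := rfl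

/-- The action of the framed braid group on tensor space by invertible operators. -/
def repUnits (D : Finset (ZMod d)) (N : ℕ) {q : ℂ} (hq : q ≠ 0) (n : ℕ) :
    Framed d n →* (Module.End ℂ (WordFn D N n))ˣ :=
  PresentedGroup.toGroup
    (f := fun x => match x with
      | FramedGen.sigma i => rUnit hq (lo i) (hi i)
      | FramedGen.t j => tUnit D N j) (by
    rintro r (⟨i, j, h⟩ | ⟨i, j, h⟩ | ⟨i, j⟩ | ⟨i, j⟩ | ⟨j⟩)
    · have hij : lo j = hi i := Fin.ext h.symm
      simp only [map_mul, map_inv, FreeGroup.lift_apply_of, mul_inv_eq_one]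
      refine Units.ext ?_
      simp only [Units.val_mul, rUnit, hij]
      refine rOp_braid hq ?_ ?_ ?_ <;> simp only [lo, hi, ne_eq, Fin.mk.injEq] <;> omega
    · simp only [map_mul, map_inv, FreeGroup.lift_apply_of, mul_inv_eq_one]
      refine Units.ext (commute_rOp_rOp q ?_ ?_ ?_ ?_) <;>
        simp only [lo, hi, ne_eq, Fin.mk.injEq] <;> omega
    · simp only [map_mul, map_inv, FreeGroup.lift_apply_of, mul_inv_eq_one]
      refine Units.ext ?_
      simp only [Units.val_mul, val_tUnit, ← map_mul, mul_comm]
    · simp only [map_mul, map_inv, FreeGroup.lift_apply_of, mul_inv_eq_one]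
      exact Units.ext (diag_colourChar_mul_rOp q _ _ _)
    · simp only [map_pow, FreeGroup.lift_apply_of]
      refine Units.ext ?_
      rw [Units.val_pow_eq_pow_val, val_tUnit, ← map_pow, colourChar_pow_card, map_one,
        Units.val_one])

/-- The representation of the framed braid group on tensor space. -/
def rep (D : Finset (ZMod d)) (N : ℕ) {q : ℂ} (hq : q ≠ 0) (n : ℕ) :
    Representation ℂ (Framed d n) (WordFn D N n) :=
  (Units.coeHom _).comp (repUnits D N hq n)

variable {q : ℂ} (hq : q ≠ 0)

theorem repUnits_sigma (i : Fin (n - 1)) :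
    repUnits D N hq n (sigma i) = rUnit hq (lo i) (hi i) := PresentedGroup.toGroup.of _

theorem repUnits_t (j : Fin n) : repUnits D N hq n (t j) = tUnit D N j :=
  PresentedGroup.toGroup.of _

theorem rep_sigma (i : Fin (n - 1)) : rep D N hq n (sigma i) = rOp q (lo i) (hi i) :=
  congrArg Units.val (repUnits_sigma hq i)

theorem rep_t (j : Fin n) : rep D N hq n (t j) = diag ℂ _ (colourChar j) :=
  congrArg Units.val (repUnits_t hq j)

theorem rep_tt_apply (i : Fin (n - 1)) (s : ℕ) (f : WordFn D N n) (w : Fin n → D × Fin N) :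
    rep D N hq n (tt i s) f w =
      ZMod.stdAddChar ((((w (lo i)).1 : ZMod d) - ((w (hi i)).1 : ZMod d)) * (s : ZMod d)) *
        f w := by
  have h : rep D N hq n (tt i s) =
      diag ℂ _ (colourChar (lo i) ^ s * colourChar (hi i) ^ ((d - 1) * s)) := by
    simp only [tt, t_pow_inv, map_mul, map_pow, rep_t]
  rw [h, diag_apply, Pi.mul_apply, colourChar_pow_apply, colourChar_pow_apply,
    ← AddChar.map_add_eq_mul, natCast_pred_mul]
  congr 2
  ring

theorem sum_rep_tt (i : Fin (n - 1)) : ∑ s ∈ Finset.Icc 1 d, rep D N hq n (tt i s) =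
    (d : ℂ) • diag ℂ _ (sameColour (lo i) (hi i)) := by
  refine LinearMap.ext fun f => funext fun w => ?_
  simp only [LinearMap.smul_apply, LinearMap.sum_apply, Pi.smul_apply, Finset.sum_apply,
    rep_tt_apply, diag_apply, smul_eq_mul, ← Finset.sum_mul, sameColour]
  rw [sum_Icc_eq_sum_zmod fun s => (ZMod.stdAddChar
    ((((w (lo i)).1 : ZMod d) - ((w (hi i)).1 : ZMod d)) * s) : ℂ), sum_char]
  simp only [sub_eq_zero, Subtype.coe_inj, mul_ite, ite_mul, mul_zero, zero_mul, one_mul]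

theorem rep_mem_quadratic (n : ℕ) : ⇑(rep D N hq n) ∈ quadratic ((q - q⁻¹) / d) := by
  intro i a b
  have hd : (d : ℂ) ≠ 0 := Nat.cast_ne_zero.mpr (NeZero.ne d)
  simp only [map_mul, pow_two, rep_sigma, ← Finset.sum_mul, ← Finset.mul_sum, sum_rep_tt,
    rOp_mul_self hq]
  simp only [mul_add, add_mul, mul_one, smul_mul_assoc, mul_smul_comm, smul_smul, mul_assoc,
    div_mul_cancel₀ _ hd]

theorem commute_diag_weight_rep (μ : D × Fin N → ℂ) (x : Framed d n) :
    Commute (diag ℂ _ (weight μ n)) (rep D N hq n x) := by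
  induction x using induction_on with
  | one => simp
  | sigma i =>
    rw [rep_sigma]
    exact commute_diag_rOp q fun w => Equiv.prod_comp (Equiv.swap (lo i) (hi i)) fun j => μ (w j)
  | t j => rw [rep_t, Commute, SemiconjBy, ← map_mul, ← map_mul, mul_comm]
  | mul a b ha hb => rw [map_mul]; exact ha.mul_right hb
  | inv a ha => exact comp_map_inv_eq_of_comp_map_eq ha

theorem restrict_comp_rep_succ (a : D × Fin N) (x : Framed d n) :
    restrict a ∘ₗ rep D N hq (n + 1) (succ d n x) = rep D N hq n x ∘ₗ restrict a := by
  induction x using induction_on with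
  | one => simp only [map_one, Module.End.one_eq_id, LinearMap.comp_id, LinearMap.id_comp]
  | sigma i =>
    rw [succ_sigma, rep_sigma, rep_sigma]
    exact restrict_comp_rOp q (lo i) (hi i) a
  | t j =>
    rw [succ_t, rep_t, rep_t]
    refine LinearMap.ext fun f => funext fun w => ?_
    simp only [LinearMap.comp_apply, restrict_apply, diag_apply, colourChar, Fin.snoc_castSucc]
  | mul x y hx hy =>
    rw [map_mul, map_mul, map_mul, Module.End.mul_eq_comp, Module.End.mul_eq_comp,
      ← LinearMap.comp_assoc, hx, LinearMap.comp_assoc, hy, LinearMap.comp_assoc]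
  | inv x hx =>
    exact comp_map_inv_eq_of_comp_map_eq (ρ := (rep D N hq (n + 1)).comp (succ d n)) hx

/-- The trace of the action on tensor space, weighted by the letters of the words. -/
def tensorTrace (D : Finset (ZMod d)) (N n : ℕ) (x : Framed d n) : ℂ :=
  LinearMap.trace ℂ _ (rep D N hq n x * diag ℂ _ (weight (letterWeight q) n))

theorem tensorTrace_mem_quadratic (n : ℕ) :
    tensorTrace hq D N n ∈ quadratic ((q - q⁻¹) / d) := by
  intro i a b
  simp only [tensorTrace, rep_mem_quadratic hq n i a b, add_mul, smul_mul_assoc, Finset.sum_mul,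
    map_add, map_smul, map_sum]

theorem sum_letterWeight_mul_colourChar_pow (hN : (q⁻¹ ^ 2) ^ N ≠ 1) (s : ℕ)
    (w : Fin n → D × Fin N) : ∑ a, letterWeight q a *
      (colourChar (Fin.last n) ^ s : WordFn D N (n + 1)) (Fin.snoc w a) = XD D s := by
  simp only [colourChar_pow_apply, Fin.snoc_last]
  rw [sum_letterWeight_mul hN fun c : D =>
      (ZMod.stdAddChar ((c : ZMod d) * (s : ZMod d)) : ℂ), XD,
    Finset.sum_coe_sort D fun c => (ZMod.stdAddChar (c * (s : ZMod d)) : ℂ), Fintype.card_coe,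
    one_div]

theorem isMarkovFn_tensorTrace (hN : (q⁻¹ ^ 2) ^ N ≠ 1) :
    IsMarkovFn (XD D) ((q - q⁻¹) / d) (q * baseWeight D.card N q) (tensorTrace hq D N) where
  one := by
    rw [tensorTrace, trace_eq_sum_apply_single]
    simp [diag_apply, weight]
  trace n a b := by
    rw [tensorTrace, tensorTrace, map_mul (rep D N hq n), map_mul (rep D N hq n), mul_assoc,
      ← (commute_diag_weight_rep hq _ b).eq, ← mul_assoc, LinearMap.trace_mul_comm, mul_assoc]
  markov n a := by
    rw [tensorTrace, map_mul (rep D N hq _), rep_sigma, ← Fintype.card_coe]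
    exact trace_mul_mul_diag_weight_succ (restrict_comp_rep_succ hq · a)
      (partial_trace_rOp (letterWeight_rel hq))
  framing n a s := by
    rw [tensorTrace, map_mul (rep D N hq _), map_pow, rep_t, ← map_pow]
    exact trace_mul_mul_diag_weight_succ (restrict_comp_rep_succ hq · a)
      (partial_trace_diag (sum_letterWeight_mul_colourChar_pow hN s))
  quad := tensorTrace_mem_quadratic hq

end Representation

/-! ### Existence of Markov functions -/

theorem eq_of_evalEval_eq {R : Type*} [CommRing R] [IsDomain R] {u : ℕ → R} {v : ℕ → ℕ → R}
    (hu : Function.Injective u) (hv : ∀ m, Function.Injective (v m)) {p p' : R[X][X]}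
    (h : ∀ m N, p.evalEval (u m) (v m N) = p'.evalEval (u m) (v m N)) : p = p' := by
  have eq_at_u (m : ℕ) : p.map (evalRingHom (u m)) = p'.map (evalRingHom (u m)) :=
    eq_of_infinite_eval_eq _ _ <| Set.infinite_of_injective_forall_mem (hv m) fun N => by
      simpa only [Set.mem_ofPred_eq, map_evalRingHom_eval] using h m N
  ext1 k
  exact eq_of_infinite_eval_eq _ _ <| Set.infinite_of_injective_forall_mem hu fun m => by
    simpa using congrArg (fun f => coeff f k) (eq_at_u m)

theorem pow_succ_ne_one_of_injective {M : Type*} [Monoid M] {x : M}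
    (hx : Function.Injective fun N : ℕ => x ^ N) (N : ℕ) : x ^ (N + 1) ≠ 1 := fun h =>
  N.succ_ne_zero (hx (h.trans (pow_zero x).symm))

theorem baseWeight_succ_injective {𝕜 : Type*} [Field 𝕜] {q : 𝕜} {m : ℕ} (hm : (m : 𝕜) ≠ 0)
    (hq : Function.Injective fun N : ℕ => (q⁻¹ ^ 2) ^ N) :
    Function.Injective fun N => baseWeight m (N + 1) q := by
  have ne (N : ℕ) : 1 - (q⁻¹ ^ 2) ^ (N + 1) ≠ 0 :=
    sub_ne_zero.mpr (pow_succ_ne_one_of_injective hq N).symm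
  intro N N' h
  have h_div := mul_left_cancel₀ (inv_ne_zero hm) h
  rw [div_eq_div_iff (ne N) (ne N')] at h_div
  have h_mul := mul_left_cancel₀ (by simpa only [zero_add, pow_one] using ne 0) h_div
  exact (Nat.succ_injective (hq (sub_right_injective h_mul))).symm

theorem natCast_add_two_ne_zero (m : ℕ) : ((m + 2 : ℕ) : ℂ) ≠ 0 :=
  Nat.cast_ne_zero.mpr (by omega)

theorem inv_sq_pow_natCast_add_two_injective (m : ℕ) :
    Function.Injective fun N : ℕ => (((m + 2 : ℕ) : ℂ)⁻¹ ^ 2) ^ N := by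
  intro N N' h
  simp only [← pow_mul, inv_pow, ← Nat.cast_pow, inv_inj, Nat.cast_inj] at h
  have := Nat.pow_right_injective (le_add_self : 2 ≤ m + 2) h
  omega

theorem natCast_add_two_sub_inv_injective :
    Function.Injective fun m : ℕ => ((m + 2 : ℕ) : ℂ) - ((m + 2 : ℕ) : ℂ)⁻¹ := by
  intro m m' h
  have hm := natCast_add_two_ne_zero m
  have hm' := natCast_add_two_ne_zero m'
  simp only at h
  generalize hk : m + 2 = k at h hm
  generalize hl : m' + 2 = l at h hm'
  have factored : ((k : ℂ) - l) * ((k * l + 1 : ℕ) : ℂ) = 0 := by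
    push_cast
    field_simp at h
    linear_combination h
  have hkl : k = l := by
    exact_mod_cast sub_eq_zero.mp
      ((mul_eq_zero.mp factored).resolve_right (Nat.cast_ne_zero.mpr (Nat.succ_ne_zero _)))
  omega

section Existence

variable {d : ℕ} [NeZero d] {D : Finset (ZMod d)}

theorem exists_isMarkovFn_polynomial_polynomial (hD : D.Nonempty) :
    ∃ φ : ∀ n, Framed d n → ℂ[X][X],
      IsMarkovFn (fun s => C (C (XD D s))) (C (X * C (d : ℂ)⁻¹)) X φ := by
  let u (m : ℕ) : ℂ := (m + 2 : ℕ) - ((m + 2 : ℕ) : ℂ)⁻¹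
  let v (m N : ℕ) : ℂ := (m + 2 : ℕ) * baseWeight D.card (N + 1) ((m + 2 : ℕ) : ℂ)
  have hv (m : ℕ) : Function.Injective (v m) :=
    (mul_right_injective₀ (natCast_add_two_ne_zero m)).comp (baseWeight_succ_injective
      (Nat.cast_ne_zero.mpr hD.card_ne_zero) (inv_sq_pow_natCast_add_two_injective m))
  let ev : ℂ[X][X] →+* (ℕ × ℕ → ℂ) := RingHom.pi fun j => evalEvalRingHom (u j.1) (v j.1 j.2)
  have ev_apply (p : ℂ[X][X]) (j : ℕ × ℕ) : ev p j = p.evalEval (u j.1) (v j.1 j.2) := rfl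
  have hev : Function.Injective ev := fun p p' h =>
    eq_of_evalEval_eq natCast_add_two_sub_inv_injective hv fun m N => congrFun h (m, N)
  refine IsMarkovFn.exists_lift hev (IsMarkovFn.pi
    (φ := fun j => tensorTrace (natCast_add_two_ne_zero j.1) D (j.2 + 1)) fun j => ?_)
  simp only [ev_apply, evalEval_C, evalEval_X, eval_mul, eval_X, eval_C, ← div_eq_mul_inv]
  exact isMarkovFn_tensorTrace _
    (pow_succ_ne_one_of_injective (inv_sq_pow_natCast_add_two_injective j.1) j.2)

theorem exists_isMarkovFn_polynomial (hD : D.Nonempty) (h : ℂ) :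
    ∃ φ : ∀ n, Framed d n → ℂ[X], IsMarkovFn (fun s => C (XD D s)) (C (h / d)) X φ := by
  obtain ⟨φ, hφ⟩ := exists_isMarkovFn_polynomial_polynomial hD
  refine ⟨fun n a => (φ n a).map (evalRingHom h), ?_⟩
  simpa [div_eq_inv_mul] using hφ.map (mapRingHom (evalRingHom h))

end Existence

/-! ### Descent to the Yokonuma–Hecke algebra -/

namespace Y

variable {d : ℕ} {q : ℂ} {n : ℕ}

theorem induction_on {p : Y d q n → Prop} (a : Y d q n) (of : ∀ x, p (ofFramed d q n x))
    (add : ∀ a b, p a → p b → p (a + b)) (smul : ∀ (c : ℂ) a, p a → p (c • a)) : p a := by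
  obtain ⟨b, rfl⟩ := RingQuot.mkAlgHom_surjective ℂ (QuadRel d q n) a
  induction b using MonoidAlgebra.induction_on with
  | of x => exact of x
  | add a b ha hb => rw [map_add]; exact add _ _ ha hb
  | smul c a ha => rw [map_smul]; exact smul _ _ ha

theorem linearMap_ext {M : Type*} [AddCommMonoid M] [Module ℂ M] {f f' : Y d q n →ₗ[ℂ] M}
    (h : ∀ x, f (ofFramed d q n x) = f' (ofFramed d q n x)) : f = f' := by
  ext1 a
  induction a using Y.induction_on with
  | of x => exact h x
  | add a b ha hb => rw [map_add, map_add, ha, hb]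
  | smul c a ha => rw [map_smul, map_smul, ha]

theorem incl_ofFramed (x : Framed d n) :
    incl d q n (ofFramed d q n x) = ofFramed d q (n + 1) (succ d n x) := by
  simp only [incl, ofFramed, proj, MonoidHom.comp_apply, MonoidHom.coe_coe,
    RingQuot.liftAlgHom_mkAlgHom_apply]
  simp [grp]

theorem e_eq (i : Fin (n - 1)) :
    (e i : Y d q n) = (1 / (d : ℂ)) • ∑ s ∈ Finset.Icc 1 d, ofFramed d q n (tt i s) := by
  simp only [e, idem, map_smul, map_sum]
  rfl

theorem ofFramed_mem_quadratic : ⇑(ofFramed d q n) ∈ quadratic ((q - q⁻¹) / d) := by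
  intro i a b
  have rel : proj d q n _ = proj d q n _ :=
    RingQuot.mkAlgHom_rel ℂ (QuadRel.quad (d := d) (q := q) i)
  have sigma_sq : ofFramed d q n (sigma i) ^ 2 =
      1 + (q - q⁻¹) • (e i * ofFramed d q n (sigma i)) := by
    simp only [map_add, map_mul, map_pow, map_smul, map_one] at rel
    exact rel
  simp only [map_mul, map_pow, sigma_sq, e_eq]
  simp only [mul_add, add_mul, mul_one, smul_mul_assoc, mul_smul_comm, Finset.sum_mul,
    Finset.mul_sum, smul_smul, mul_assoc, mul_one_div]

end Y

section Descent

variable {d n : ℕ} {R M : Type*} [CommRing R] [AddCommGroup M] [Module R M] {H : R}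

/-- The action of `F_{d,n}` on the functions that respect the quadratic relations by right
translation, `(x ψ)(a) = ψ(a x)`. -/
def rightTranslation (d n : ℕ) (M : Type*) [AddCommGroup M] [Module R M] (H : R) :
    Representation R (Framed d n) (quadratic (d := d) (n := n) (M := M) H) where
  toFun x :=
    { toFun := fun ψ => ⟨fun a => ψ.1 (a * x), comp_mul_right_mem_quadratic ψ.2 x⟩
      map_add' := fun _ _ => rfl
      map_smul' := fun _ _ => rfl }
  map_one' := by ext; simp
  map_mul' x y := by ext; simp [mul_assoc]

theorem rightTranslation_apply (x a : Framed d n) (ψ : quadratic (d := d) (n := n) (M := M) H) :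
    (rightTranslation d n M H x ψ).1 a = ψ.1 (a * x) := rfl

theorem rightTranslation_mem_quadratic :
    ⇑(rightTranslation d n M H) ∈ quadratic H := fun i a b => by
  refine LinearMap.ext fun ψ => Subtype.ext (funext fun c => ?_)
  have h := ψ.2 i (c * a) b
  simpa only [LinearMap.add_apply, LinearMap.smul_apply, LinearMap.sum_apply, Submodule.coe_add,
    Submodule.coe_smul, Submodule.coe_sum, Pi.add_apply, Pi.smul_apply, Finset.sum_apply,
    rightTranslation_apply, mul_assoc] using h

end Descent

namespace Y

variable {d : ℕ} {q : ℂ} {n : ℕ}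

theorem apply_incl_mul_eq {T : Y d q (n + 1) →ₗ[ℂ] ℂ[X]} {T' : Y d q n →ₗ[ℂ] ℂ[X]}
    {g : Y d q (n + 1)} {p : ℂ[X]}
    (h : ∀ x, T (ofFramed d q (n + 1) (succ d n x) * g) = p * T' (ofFramed d q n x))
    (a : Y d q n) : T (incl d q n a * g) = p * T' a := by
  induction a using Y.induction_on with
  | of x => rw [incl_ofFramed, h]
  | add a b ha hb => rw [map_add, add_mul, map_add, map_add, mul_add, ha, hb]
  | smul c a ha => rw [map_smul, smul_mul_assoc, map_smul, map_smul, mul_smul_comm, ha]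

theorem exists_algHom {A : Type*} [Ring A] [Algebra ℂ A] {f : Framed d n →* A}
    (hf : ⇑f ∈ quadratic ((q - q⁻¹) / d)) :
    ∃ F : Y d q n →ₐ[ℂ] A, ∀ x, F (ofFramed d q n x) = f x := by
  have lift_grp (x : Framed d n) : MonoidAlgebra.lift ℂ A (Framed d n) f (grp x) = f x :=
    MonoidAlgebra.lift_of f x
  have respects ⦃a b : MonoidAlgebra ℂ (Framed d n)⦄ (h : QuadRel d q n a b) :
      MonoidAlgebra.lift ℂ A (Framed d n) f a = MonoidAlgebra.lift ℂ A (Framed d n) f b := by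
    obtain ⟨i⟩ := h
    have h := hf i 1 1
    simp only [one_mul, mul_one, map_one, map_mul f, map_pow f] at h
    simp only [idem, ← tt.eq_1, map_pow, map_add, map_mul, map_smul, map_sum, map_one, lift_grp,
      h, smul_mul_assoc, Finset.sum_mul, smul_smul, mul_one_div]
  refine ⟨RingQuot.liftAlgHom ℂ ⟨_, respects⟩, fun x => ?_⟩
  rw [ofFramed, MonoidHom.comp_apply, ← lift_grp]
  exact RingQuot.liftAlgHom_mkAlgHom_apply ..

theorem exists_linearMap {M : Type*} [AddCommGroup M] [Module ℂ M] {ψ : Framed d n → M}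
    (hψ : ψ ∈ quadratic ((q - q⁻¹) / d)) :
    ∃ T : Y d q n →ₗ[ℂ] M, ∀ x, T (ofFramed d q n x) = ψ x := by
  let V := quadratic (d := d) (n := n) (M := M) ((q - q⁻¹) / d)
  obtain ⟨F, hF⟩ := exists_algHom (q := q) (A := Module.End ℂ V)
    (f := rightTranslation d n M _) fun i a b => rightTranslation_mem_quadratic i a b
  -- `T a` is the value at `1` of the translate of `ψ` by `a`.
  refine ⟨LinearMap.proj 1 ∘ₗ Submodule.subtype _ ∘ₗ LinearMap.applyₗ ⟨ψ, hψ⟩ ∘ₗ F.toLinearMap,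
    fun x => ?_⟩
  change (F (ofFramed d q n x) ⟨ψ, hψ⟩).1 1 = ψ x
  rw [hF, rightTranslation_apply, one_mul]

end Y

/-! ### The Markov trace -/

section Trace

variable {d : ℕ} {x : ZMod d → ℂ} {q : ℂ}

theorem IsMarkovFn.exists_isMarkovTrace {φ : ∀ n, Framed d n → ℂ[X]}
    (hφ : IsMarkovFn (fun s => C (x s)) (C ((q - q⁻¹) / d)) X φ) (hx : x 0 = 1) :
    ∃ T : ∀ n : ℕ, Y d q n →ₗ[ℂ] ℂ[X], IsMarkovTrace d q x T := by
  have hCx : C (x 0) = 1 := by rw [hx, C_1]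
  choose T hT using fun n =>
    Y.exists_linearMap (q := q) (mem_quadratic_algebraMap_iff.mp (hφ.quad n))
  refine ⟨T, fun n a => ?_, fun n a b => ?_, fun n => ?_, fun n => Y.apply_incl_mul_eq fun a => ?_,
    fun n a s _ _ => Y.apply_incl_mul_eq (fun a => ?_) a⟩
  · have h := Y.apply_incl_mul_eq (T := T (n + 1)) (T' := T n) (g := 1) (p := 1) fun a => by
      rw [mul_one, one_mul, hT, hT, hφ.succ hCx]
    simpa only [mul_one, one_mul] using h a
  · induction a using Y.induction_on with
    | of x =>
      induction b using Y.induction_on with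
      | of y => rw [← map_mul, ← map_mul, hT, hT, hφ.trace]
      | add a b ha hb => rw [mul_add, add_mul, map_add, map_add, ha, hb]
      | smul c a ha => rw [mul_smul_comm, smul_mul_assoc, map_smul, map_smul, ha]
    | add a b ha hb => rw [mul_add, add_mul, map_add, map_add, ha, hb]
    | smul c a ha => rw [mul_smul_comm, smul_mul_assoc, map_smul, map_smul, ha]
  · rw [← map_one (Y.ofFramed d q n), hT, hφ.apply_one hCx]
  · rw [Y.g, ← map_mul, hT, hT]
    exact hφ.markov n a
  · rw [Y.t, ← map_pow, ← map_mul, hT, hT, hφ.framing]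

variable [NeZero d]

theorem IsMarkovTrace.isMarkovFn {T : ∀ n : ℕ, Y d q n →ₗ[ℂ] ℂ[X]} (hT : IsMarkovTrace d q x T)
    (hx : x 0 = 1) :
    IsMarkovFn (fun s => C (x s)) (C ((q - q⁻¹) / d)) X fun n a => T n (Y.ofFramed d q n a) where
  one := by rw [map_one, hT.one]
  trace n a b := by rw [map_mul (Y.ofFramed d q n), map_mul (Y.ofFramed d q n), hT.trace]
  markov n a := by
    rw [map_mul (Y.ofFramed d q _), ← Y.incl_ofFramed]
    exact hT.markov n _
  framing n a s := by
    rw [pow_eq_pow_mod s (t_pow (Fin.last n)), map_mul (Y.ofFramed d q _), map_pow,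
      ← Y.incl_ofFramed, ← ZMod.natCast_mod s d]
    rcases Nat.eq_zero_or_pos (s % d) with hs | hs
    · rw [hs, pow_zero, mul_one, hT.compat, Nat.cast_zero, hx, C_1, one_mul]
    · exact hT.framing n _ (s % d) hs (Nat.le_sub_one_of_lt (Nat.mod_lt s (NeZero.pos d)))
  quad n := mem_quadratic_algebraMap_iff.mpr fun i a b => by
    simp only [Y.ofFramed_mem_quadratic i a b, map_add, map_smul, map_sum]

theorem IsMarkovTrace.unique {T T' : ∀ n : ℕ, Y d q n →ₗ[ℂ] ℂ[X]} (hT : IsMarkovTrace d q x T)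
    (hT' : IsMarkovTrace d q x T') (hx : x 0 = 1) : T = T' :=
  funext fun n => Y.linearMap_ext fun a =>
    congrFun₂ ((hT.isMarkovFn hx).unique (hT'.isMarkovFn hx)) n a

variable {D : Finset (ZMod d)}

theorem sum_C_XD_mul_C_XD (hD : D.Nonempty) (m : ZMod d) :
    ∑ s, C (XD D (m + s)) * C (XD D (-s)) = C (d * ED D) * C (XD D m) := by
  have hd : (d : ℂ) ≠ 0 := Nat.cast_ne_zero.mpr (NeZero.ne d)
  have h := EE_XD D m
  rw [← ED_eq D hD, EE, one_div, inv_mul_eq_iff_eq_mul₀ hd, ← mul_assoc] at h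
  simp only [← C_mul, ← map_sum, h]

theorem isMarkovTrace_tr (hD : D.Nonempty) (q : ℂ) : IsMarkovTrace d q (XD D) (tr D q) := by
  obtain ⟨φ, hφ⟩ := exists_isMarkovFn_polynomial hD (q - q⁻¹)
  exact Classical.epsilon_spec (hφ.exists_isMarkovTrace (XD_zero D hD))

theorem isMarkovFn_tr (hD : D.Nonempty) (q : ℂ) : IsMarkovFn (fun s => C (XD D s))
    (C ((q - q⁻¹) / d)) X fun n a => tr D q n (Y.ofFramed d q n a) :=
  (isMarkovTrace_tr hD q).isMarkovFn (XD_zero D hD)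

theorem tr_e (hD : D.Nonempty) (q : ℂ) {n : ℕ} (i : Fin (n - 1)) :
    tr D q n (Y.e i) = C (ED D) := by
  have hd : (d : ℂ) ≠ 0 := Nat.cast_ne_zero.mpr (NeZero.ne d)
  have h := (isMarkovFn_tr hD q).sum_apply_tt (by rw [XD_zero D hD, C_1])
    (sum_C_XD_mul_C_XD hD) i
  rw [Y.e_eq, map_smul, map_sum, h, smul_C, smul_eq_mul, one_div, inv_mul_cancel_left₀ hd]

theorem tr_mirror (hD : D.Nonempty) (q : ℂ) {n : ℕ} (a : Framed d n) :
    tr D q n (Y.ofFramed d q n (mirror d n a)) =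
      (tr D q⁻¹ n (Y.ofFramed d q⁻¹ n a)).comp (X - C ((q - q⁻¹) * ED D)) := by
  have hd : (d : ℂ) ≠ 0 := Nat.cast_ne_zero.mpr (NeZero.ne d)
  have mirrored := (isMarkovFn_tr hD q).comp_mirror (sum_C_XD_mul_C_XD hD)
  have substituted :=
    (isMarkovFn_tr hD q⁻¹).map (compRingHom (X - C ((q - q⁻¹) * ED D)))
  have hH : -C ((q - q⁻¹) / d) = C ((q⁻¹ - q⁻¹⁻¹) / d) := by
    rw [← C_neg, inv_inv, ← neg_div, neg_sub]
  have hz : (X : ℂ[X]) - C ((q - q⁻¹) / d) * C (d * ED D) = X - C ((q - q⁻¹) * ED D) := by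
    rw [← C_mul, ← mul_assoc, div_mul_cancel₀ _ hd]
  rw [hH, hz] at mirrored
  simp only [coe_compRingHom_apply, C_comp, X_comp] at substituted
  exact congrFun₂ (mirrored.unique substituted) n a

theorem brTr_mirror (hD : D.Nonempty) (q : ℂ) {n : ℕ} (α : Braid n) :
    brTr D q (Braid.mirror n α) = (brTr D q⁻¹ α).comp (X - C ((q - q⁻¹) * ED D)) := by
  rw [brTr, brTr, Y.ofBraid, Y.ofBraid, MonoidHom.comp_apply, MonoidHom.comp_apply,
    ofBraid_mirror, tr_mirror hD]

theorem zD_inv (D : Finset (ZMod d)) (q : ℂ) {lam : ℂ} (h0 : lam ≠ 0) (h1 : lam ≠ 1) :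
    zD D q⁻¹ lam⁻¹ = zD D q lam - (q - q⁻¹) * ED D := by
  have one_sub_ne : 1 - lam ≠ 0 := sub_ne_zero.mpr h1.symm
  have one_sub_inv : 1 - lam⁻¹ = -(1 - lam) / lam := by field_simp; ring
  rw [zD, zD, one_sub_inv, inv_inv]
  field_simp
  ring

theorem brTrLam_mirror (hD : D.Nonempty) (q : ℂ) {lam : ℂ} (h0 : lam ≠ 0) (h1 : lam ≠ 1) {n : ℕ}
    (α : Braid n) : brTrLam D q lam (Braid.mirror n α) = brTrLam D q⁻¹ lam⁻¹ α := by
  rw [brTrLam, brTrLam, brTr_mirror hD, eval_comp, eval_sub, eval_X, eval_C, zD_inv D q h0 h1]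

end Trace

end

end YokonumaHecke

open YokonumaHecke in
theorem mainTheorem5 (d : ℕ) [NeZero d] (D : Finset (ZMod d)) (hD : D.Nonempty)
    (q : ℂ) (hq : q ≠ 0) :
    -- `tr_{d,D}` is well defined, and `E_D = tr_{d,D}(e_i)`
    ((∃! T : ∀ n : ℕ, Y d q n →ₗ[ℂ] Polynomial ℂ, IsMarkovTrace d q (XD D) T) ∧
      ∀ (n : ℕ) (i : Fin (n - 1)), tr D q n (Y.e i) = Polynomial.C (ED D)) ∧
    ∀ (n : ℕ) (α : Braid n),
      -- the identity in the variables `(q, z)`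
      brTr D q (Braid.mirror n α) =
        (brTr D q⁻¹ α).comp (Polynomial.X - Polynomial.C ((q - q⁻¹) * ED D)) ∧
      -- the identity in the variables `(q, λ_D)`
      ∀ lam : ℂ, lam ≠ 0 → lam ≠ 1 →
        brTrLam D q lam (Braid.mirror n α) = brTrLam D q⁻¹ lam⁻¹ α :=
  ⟨⟨⟨tr D q, isMarkovTrace_tr hD q, fun _ hT => hT.unique (isMarkovTrace_tr hD q) (XD_zero D hD)⟩,
      fun _ i => tr_e hD q i⟩,
    fun _ α => ⟨brTr_mirror hD q α, fun _ h0 h1 => brTrLam_mirror hD q h0 h1 α⟩⟩
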